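/- Let $\mathbb S^2\subset\mathbb R^3$ be the unit sphere with the distance $\|x-y\|$, let $F_2$ be the (discrete) free group on $a,b$, and let $S=\{a,a^{-1},b,b^{-1}\}$. For an action $\Phi$ of $F_2$ on $\mathbb S^2$ by homeomorphisms and two sets $I_a,I_b\subset \mathbb S^2$ put $I_{t^{-1}}=\big(\overline{\Phi_t^{-1}(I_t)}\big)^c$ for $t\in\{a,b\}$, $A_0=\bigcup_{s\in S}I_s$, $A_{n+1}=A_n\cap\bigcap_{s\in S}\Phi_s(A_n)$ and $K_\Phi=\bigcap_{n}A_n$ (for another action $\widetilde\Phi$, $K_{\widetilde\Phi}$ is formed in the same way from the same sets $I_a,I_b$). An action $\Phi$ is $C^0$-stable if for every $\varepsilon>0$ there is $\delta>0$ such that for every action $\widetilde\Phi$ with $d^0_S(\widetilde\Phi,\Phi)=\max_{s\in S}\sup_x d(\widetilde\Phi_s(x),\Phi_s(x))<\delta$ there is a continuous surjection $h$ of $\mathbb S^2$ with $h\widetilde\Phi_g=\Phi_gh$ for all $g\in F_2$ and $\sup_x d(h(x),x)<\varepsilon$. An action $\Phi$ with all $\Phi_s$ ($s\in S$) of class $C^1$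 is $C^1$-stable if there is $\delta>0$ such that for every action $\widetilde\Phi$ with all $\widetilde\Phi_s$ of class $C^1$ and $d^1_S(\widetilde\Phi,\Phi)<\delta$ there is a homeomorphism $h$ of $\mathbb S^2$ with $h\widetilde\Phi_g=\Phi_gh$ for all $g$; here $d^1_S$ is the maximum over $s\in S$ of the uniform distances between $\widetilde\Phi_s$ and $\Phi_s$ and between their derivatives $D\widetilde\Phi_s$ and $D\Phi_s$ (as linear maps $T_x\mathbb S^2\to\mathbb R^3$). The action is expansive if there is $\alpha>0$ such that for all $x\ne y$ some $g$ satisfies $d(\Phi_g(x),\Phi_g(y))>\alpha$. A nonempty set $M$ is minimal if it is the closure of the orbit of each of its points. **Theorem.** There are an action $\Phi$ of $F_2$ on $\mathbb S^2$ and sets $I_a,I_b\subset \mathbb S^2$ with the following properties. 1. (Construction.) $\Phi_a,\Phi_b$ are $C^1$ diffeomorphisms. For $t\in\{a,b\}$ there is a point $p=S_t\in \mathbb S^2$, with antipode $N_t=-S_t$, such that $\Phi_t$ is a north–south pole map with source $N_t$, sink $S_t$ and non-wandering set $\{N_t,S_t\}$; in polar coordinates around $p$ it has the form $(r,\theta)\mapsto(f_t(r),\theta)$,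 where $r\in[0,\pi]$ is the angle to $p$ and $f_t$ is an increasing $C^1$ map of $[0,\pi]$ onto itself; $I_t=\{r<c_t\}$ for some $c_t\in(0,\pi)$, and $N_t\in I_{t^{-1}}$. The closures of $I_a,I_{a^{-1}},I_b,I_{b^{-1}}$ are pairwise disjoint. For $t\in\{a,b\}$, $\|\Phi_t^{-1}(x)-\Phi_t^{-1}(y)\|>2\|x-y\|$ for all distinct $x,y\in I_t$. For $s\in S$, $\|\Phi_s(x)-\Phi_s(y)\|<\frac12\|x-y\|$ for all distinct $x,y\in I_s$, and also for all distinct $x,y\in I_{t}\cup I_{t^{-1}}$ where $t\in\{a,b\}$ is the generator with $t\neq s^{\pm1}$. Finally $\Phi_s(I_{s'})\subset I_s$ whenever $s,s'\in S$ and $s'\ne s^{-1}$. 2. $K=K_\Phi$ is a Cantor set (nonempty, compact, totally disconnected, without isolated points), it is a minimal set of $\Phi$, and it is the only one. 3. $\Phi$ is not expansive. 4. $\Phi$ is $C^0$-stable. 5. $\Phi$ is $C^1$-stable. 6. In the definition of $C^0$-stability, $\delta$ and $h$ can be chosen so that moreover $h(K_{\widetilde\Phi})=K$ and $h$ is constant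 on each connected component of $K_{\widetilde\Phi}$. In particular, expansiveness is not necessary for $C^0$- or $C^1$-stability. -/

import Mathlib

open Set Filter Topology Metric
open scoped Manifold ContDiff ENNReal

noncomputable section

/-! ### Actions of a discrete group, stability, expansivity, minimal sets -/

/-- The actions of the discrete group `G` on the space `X` by homeomorphisms; `Φ g` is the
homeomorphism of `X` induced by `g`. -/
abbrev Act (G X : Type*) [Group G] [TopologicalSpace X] := G →* (X ≃ₜ X)

section General

variable {G X : Type*} [Group G]

/-- The uniform distance `sup_x d(f x, g x)`, with values in `[0, ∞]`. -/
def dC0 [PseudoEMetricSpace X] (f g : X → X) : ℝ≥0∞ := ⨆ x, edist (f x) (g x)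

/-- The `C⁰` distance of two actions with respect to `S`. -/
def actDist0 [PseudoEMetricSpace X] (S : Set G) (Ψ Φ : Act G X) : ℝ≥0∞ :=
  ⨆ s ∈ S, dC0 (Ψ s) (Φ s)

/-- `h` is a semiconjugacy from the action `Ψ` to the action `Φ`. -/
def IsSemiconj [TopologicalSpace X] (h : X → X) (Ψ Φ : Act G X) : Prop :=
  Continuous h ∧ Function.Surjective h ∧ ∀ g x, h (Ψ g x) = Φ g (h x)

/-- `C⁰`-stability of an action (with respect to the generating set `S`). -/
def IsC0Stable [PseudoEMetricSpace X] (S : Set G) (Φ : Act G X) : Prop :=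
  ∀ ε : ℝ, 0 < ε → ∃ δ : ℝ, 0 < δ ∧ ∀ Ψ : Act G X, actDist0 S Ψ Φ < ENNReal.ofReal δ →
    ∃ h : X → X, IsSemiconj h Ψ Φ ∧ dC0 h id < ENNReal.ofReal ε

/-- Expansive actions. -/
def IsExpansive [PseudoMetricSpace X] (Φ : Act G X) : Prop :=
  ∃ α : ℝ, 0 < α ∧ ∀ x y : X, x ≠ y → ∃ g : G, α < dist (Φ g x) (Φ g y)

/-- Minimal sets: nonempty sets that are the closure of the orbit of each of their points. -/
def IsMinimalSet [TopologicalSpace X] (Φ : Act G X) (M : Set X) : Prop :=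
  M.Nonempty ∧ ∀ x ∈ M, closure (range fun g : G => Φ g x) = M

/-- Cantor sets: nonempty, compact, totally disconnected, without isolated points. -/
def IsCantorSet [TopologicalSpace X] (K : Set X) : Prop :=
  K.Nonempty ∧ IsCompact K ∧ IsTotallyDisconnected K ∧ Preperfect K

/-- The non-wandering set of a map. -/
def nonwanderingSet [TopologicalSpace X] (φ : X → X) : Set X :=
  {x | ∀ U ∈ 𝓝 x, ∃ n : ℕ, 1 ≤ n ∧ (φ^[n] '' U ∩ U).Nonempty}

/-- North-south pole dynamics with source `N` and sink `P`: both are fixed, they form the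
non-wandering set, forward orbits of points other than `N` tend to `P`, and backward orbits of
points other than `P` tend to `N`. -/
def IsNorthSouth [TopologicalSpace X] (φ : X ≃ₜ X) (N P : X) : Prop :=
  N ≠ P ∧ φ N = N ∧ φ P = P ∧ nonwanderingSet φ = {N, P} ∧
    (∀ x, x ≠ N → Tendsto (fun n : ℕ => φ^[n] x) atTop (𝓝 P)) ∧
    (∀ x, x ≠ P → Tendsto (fun n : ℕ => φ.symm^[n] x) atTop (𝓝 N))

end General

/-! ### The sphere and `C¹` actions on it -/

/-- Euclidean three-space. -/
abbrev E3 := EuclideanSpace ℝ (Fin 3)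

/-- The unit sphere in Euclidean three-space, with the distance `‖x - y‖`. -/
abbrev S2 := sphere (0 : E3) 1

/-- The derivative at `x`, applied to the tangent vector `v`, of a map of the sphere, regarded
as a vector of Euclidean three-space. For `f = id` this is the vector `v` itself, seen in
Euclidean three-space. -/
def sphereDeriv (f : S2 → S2) (x : S2) (v : TangentSpace (𝓡 2) x) : E3 :=
  mfderiv (𝓡 2) 𝓘(ℝ, E3) (fun y => (f y : E3)) x v

/-- The `C¹` distance of two maps of the sphere: the larger one of the uniform distance of the
maps and the uniform distance (in operator norm) of their derivatives. -/
def dC1 (f g : S2 → S2) : ℝ≥0∞ :=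
  max (dC0 f g)
    (⨆ (x : S2) (v : TangentSpace (𝓡 2) x) (_ : ‖sphereDeriv id x v‖ ≤ 1),
      edist (sphereDeriv f x v) (sphereDeriv g x v))

/-- The actions on the sphere for which every element of `S` acts by a `C¹` map. -/
def IsC1Act {G : Type*} [Group G] (S : Set G) (Φ : Act G S2) : Prop :=
  ∀ s ∈ S, ContMDiff (𝓡 2) (𝓡 2) 1 (Φ s)

/-- The `C¹` distance of two actions with respect to `S`. -/
def actDist1 {G : Type*} [Group G] (S : Set G) (Ψ Φ : Act G S2) : ℝ≥0∞ :=
  ⨆ s ∈ S, dC1 (Ψ s) (Φ s)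

/-- `C¹`-stability of an action on the sphere (with respect to the generating set `S`). -/
def IsC1Stable {G : Type*} [Group G] (S : Set G) (Φ : Act G S2) : Prop :=
  IsC1Act S Φ ∧ ∃ δ : ℝ, 0 < δ ∧ ∀ Ψ : Act G S2, IsC1Act S Ψ →
    actDist1 S Ψ Φ < ENNReal.ofReal δ → ∃ h : S2 ≃ₜ S2, ∀ g x, h (Ψ g x) = Φ g (h x)

/-! ### The ping-pong construction -/

/-- The free group on two generators `a = of 0` and `b = of 1`. -/
abbrev F2 := FreeGroup (Fin 2)

/-- The letters `a, a⁻¹, b, b⁻¹`: `(i, true)` is the `i`-th generator, `(i, false)` its inverse. -/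
abbrev Letter := Fin 2 × Bool

/-- The element of the free group given by a letter. -/
def Letter.elt : Letter → F2
  | (i, true) => FreeGroup.of i
  | (i, false) => (FreeGroup.of i)⁻¹

/-- The inverse letter. -/
def Letter.inv (s : Letter) : Letter := (s.1, !s.2)

/-- The symmetric generating set `{a, a⁻¹, b, b⁻¹}`. -/
def symGen : Set F2 := range Letter.elt

/-- The four ping-pong regions of an action: `I 0` for `a`, `I 1` for `b`, and for the inverse of
the `i`-th generator the complement of the closure of the preimage of `I i` under the
`i`-th generator. -/
def region (Φ : Act F2 S2) (I : Fin 2 → Set S2) : Letter → Set S2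
  | (i, true) => I i
  | (i, false) => (closure (Φ (FreeGroup.of i) ⁻¹' I i))ᶜ

/-- The sets `A_n`: `A_0` is the union of the four regions, and `A_{n+1}` is the intersection
of `A_n` with its images under the four letters. -/
def level (Φ : Act F2 S2) (I : Fin 2 → Set S2) : ℕ → Set S2
  | 0 => ⋃ s, region Φ I s
  | n + 1 => (⋂ s : Letter, Φ s.elt '' level Φ I n) ∩ level Φ I n

/-- The intersection of all the sets `A_n`. -/
def limitSet (Φ : Act F2 S2) (I : Fin 2 → Set S2) : Set S2 := ⋂ n, level Φ I n

/-- `φ` is given by `(t, u) ↦ (f t, u)` in polar coordinates around `p`, in which `t` is the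
angle at the origin between a point and `p`, and `u` is a unit vector orthogonal to `p`. -/
def IsRadial (φ : S2 → S2) (p : S2) (f : ℝ → ℝ) : Prop :=
  ∀ (x : S2) (t : ℝ) (u : E3), t ∈ Icc 0 Real.pi → ‖u‖ = 1 → inner ℝ (p : E3) u = 0 →
    (x : E3) = Real.cos t • (p : E3) + Real.sin t • u →
      (φ x : E3) = Real.cos (f t) • (p : E3) + Real.sin (f t) • u

/-- The action is generated by a ping-pong pair of north-south pole diffeomorphisms `Φ_a`, `Φ_b`
of the sphere, with regions determined by the discs `I 0`, `I 1`. -/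
structure IsPingPong (Φ : Act F2 S2) (I : Fin 2 → Set S2) : Prop where
  /-- The generators act by `C¹` diffeomorphisms. -/
  diffeo : IsC1Act symGen Φ
  /-- Each generator is a north-south pole map, radial around its sink `p` by an increasing `C¹`
  homeomorphism `f` of `[0, π]`, and its disc is the open spherical cap of angle `c` around `p`;
  the source lies in the region of the inverse. -/
  pole : ∀ i : Fin 2, ∃ (p : S2) (f : ℝ → ℝ) (c : ℝ),
    StrictMonoOn f (Icc 0 Real.pi) ∧ ContDiffOn ℝ 1 f (Icc 0 Real.pi) ∧
    f 0 = 0 ∧ f Real.pi = Real.pi ∧ IsRadial (Φ (FreeGroup.of i)) p f ∧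
    c ∈ Ioo 0 Real.pi ∧ I i = {x : S2 | Real.cos c < inner ℝ (p : E3) (x : E3)} ∧
    IsNorthSouth (Φ (FreeGroup.of i)) (-p) p ∧ -p ∈ region Φ I (i, false)
  /-- The closures of the regions are pairwise disjoint. -/
  disjoint : ∀ s s' : Letter, s ≠ s' →
    Disjoint (closure (region Φ I s)) (closure (region Φ I s'))
  /-- The inverse of a generator expands the region of the generator. -/
  expand : ∀ i : Fin 2, ∀ x ∈ region Φ I (i, true), ∀ y ∈ region Φ I (i, true), x ≠ y →
    2 * dist x y < dist (Φ (FreeGroup.of i)⁻¹ x) (Φ (FreeGroup.of i)⁻¹ y)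
  /-- Every letter contracts its own region. -/
  contract_self : ∀ s : Letter, ∀ x ∈ region Φ I s, ∀ y ∈ region Φ I s, x ≠ y →
    dist (Φ s.elt x) (Φ s.elt y) < 1 / 2 * dist x y
  /-- A generator and its inverse contract the union of the two regions of the other one. -/
  contract_cross : ∀ s : Letter, ∀ j : Fin 2, j ≠ s.1 →
    ∀ x ∈ region Φ I (j, true) ∪ region Φ I (j, false),
    ∀ y ∈ region Φ I (j, true) ∪ region Φ I (j, false), x ≠ y →
      dist (Φ s.elt x) (Φ s.elt y) < 1 / 2 * dist x y
  /-- The ping-pong property. -/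
  ping_pong : ∀ s s' : Letter, s' ≠ s.inv → Φ s.elt '' region Φ I s' ⊆ region Φ I s

end

/-!
The action is generated by two hyperbolic Möbius transformations of the sphere (`boost`) with
orthogonal axes. A Möbius transformation multiplies chordal distances by the geometric mean of its
conformal factors at the two points (`dist_boost_sq`), so that all contraction properties reduce
to lower bounds of the affine function `boostDen`.

For an arbitrary action `Ψ`, the region of each letter is the positivity set of a function
`regionFun Ψ s`, and these functions satisfy `regionFun Ψ s⁻¹ x = -regionFun Ψ s (Ψ s x)`. Together
with disjointness of the closed regions, which persists under perturbation, this is the structure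
`PingPong`. The limit set is then the set `pingPongSet` of points whose orbits never leave the
regions. Its points are coded by itineraries, and the contraction makes it a Cantor set and the
unique minimal set. Off the regions, reduced words act with a uniform Lipschitz constant
(`PingPong.dist_act_le`), which prevents expansiveness.

For stability, a semiconjugacy `h` from a perturbed action `Ψ` to the model `Φ` is prescribed
outside the regions of `Ψ` and extended by `h = Φ s ∘ h ∘ (Ψ s)⁻¹` on the region of `s`. Since `Φ s`
contracts all regions but that of `s⁻¹`, the resulting `graphTransform` is a contraction in the
uniform distance, and its fixed point is the required map
(`SemiconjData.exists_semiconj`). The prescribed map (`initialMap`) interpolates between the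
identity and `Φ⁻¹ ∘ Ψ` for each generator, near the region of its inverse. The map `h` respects the
regions, so the preimage of the limit set of `Φ` is that of `Ψ`; it is close to the identity, hence
surjective (`surjective_of_dist_lt`, by lifting along the complex exponential).

If `Ψ` is `C¹`-close to `Φ`, then `Ψ s - Φ s` has a small Lipschitz constant
(`norm_sub_sub_le_of_dC1`). Therefore `initialMap` is injective, and `Ψ` contracts its own
regions. The first fact makes `h` injective off the limit set, the second one on it, because points
with a common itinerary coincide (`injective_of_semiconj`).
-/

/-! ### Letters of the free group -/

namespace Letter

lemma inv_inv (s : Letter) : s.inv.inv = s := by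
  rcases s with ⟨i, b⟩; simp [Letter.inv]

lemma elt_inv (s : Letter) : s.inv.elt = s.elt⁻¹ := by
  rcases s with ⟨i, _ | _⟩ <;> simp [Letter.inv, Letter.elt]

lemma inv_ne (s : Letter) : s.inv ≠ s := by
  rcases s with ⟨i, _ | _⟩ <;> simp [Letter.inv]

lemma exists_ne (s : Letter) : ∃ t : Letter, t ≠ s ∧ t ≠ s.inv := by
  revert s; unfold Letter.inv; decide

lemma eq_or_eq_inv_or_fst_ne (s s' : Letter) : s' = s ∨ s' = s.inv ∨ s'.1 ≠ s.1 := by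
  revert s s'; unfold Letter.inv; decide

lemma mk_cons (s : Letter) (L : List Letter) :
    (FreeGroup.mk (s :: L) : F2) = s.elt * FreeGroup.mk L := by
  have : s.elt = FreeGroup.mk [s] := by
    rcases s with ⟨i, _ | _⟩
    · simp [Letter.elt, FreeGroup.of, FreeGroup.inv_mk, FreeGroup.invRev]
    · rfl
  rw [this, FreeGroup.mul_mk]; rfl

lemma exists_reduced (g : F2) :
    ∃ L : List Letter, FreeGroup.IsReduced L ∧ g = FreeGroup.mk L :=
  ⟨g.toWord, FreeGroup.isReduced_toWord, FreeGroup.mk_toWord.symm⟩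

lemma ne_inv_of_isReduced {s s' : Letter} {L : List Letter}
    (h : FreeGroup.IsReduced (s :: s' :: L)) : s' ≠ s.inv := by
  rintro rfl
  have := (FreeGroup.isReduced_cons_cons.1 h).1 rfl
  simp [Letter.inv] at this

/-- Induction over the elements of the free group, one letter at a time. -/
lemma induction {P : F2 → Prop} (one : P 1) (mul : ∀ (s : Letter) g, P g → P (s.elt * g))
    (g : F2) : P g := by
  obtain ⟨L, -, rfl⟩ := exists_reduced g
  induction L with
  | nil => exact one
  | cons s L ih => rw [mk_cons]; exact mul s _ ih

end Letter

/-! ### Ping-pong dynamics -/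

/-- Ping-pong dynamics: a continuous function `τ s` for each letter `s`, whose positivity set is
the open region of `s` and whose zero set contains the boundary of that region. The map of `s`
carries the complement of the closed region of `s⁻¹` onto the open region of `s`, and the closed
regions are pairwise disjoint. -/
structure PingPong {X : Type*} [TopologicalSpace X] (Ψ : Act F2 X) (τ : Letter → X → ℝ) :
    Prop where
  cont : ∀ s, Continuous (τ s)
  inv : ∀ s x, τ s.inv x = -τ s (Ψ s.elt x)
  disj : ∀ s s' x, s ≠ s' → 0 ≤ τ s x → τ s' x < 0

/-- Every letter contracts, by the factor `ρ`, the closed regions of the letters other than its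
inverse. -/
def Contracts {X : Type*} [MetricSpace X] (Ψ : Act F2 X) (τ : Letter → X → ℝ) (ρ : ℝ) : Prop :=
  ∀ (s s' : Letter) x y, s' ≠ s.inv → 0 ≤ τ s' x → 0 ≤ τ s' y →
    dist (Ψ s.elt x) (Ψ s.elt y) ≤ ρ * dist x y

/-- The points whose orbit never leaves the union of the open regions. -/
def pingPongSet {X : Type*} [TopologicalSpace X] (Ψ : Act F2 X) (τ : Letter → X → ℝ) : Set X :=
  {x | ∀ g, ∃ s, 0 < τ s (Ψ g x)}

section Act

variable {X : Type*} [TopologicalSpace X] (Ψ : Act F2 X)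

lemma act_mul (g g' : F2) (x : X) : Ψ (g * g') x = Ψ g (Ψ g' x) := by
  rw [map_mul]; rfl

lemma act_one (x : X) : Ψ 1 x = x := by
  rw [map_one]; rfl

lemma act_inv_act (s : Letter) (x : X) : Ψ s.inv.elt (Ψ s.elt x) = x := by
  rw [← act_mul, Letter.elt_inv, inv_mul_cancel, act_one]

lemma act_act_inv (s : Letter) (x : X) : Ψ s.elt (Ψ s.inv.elt x) = x := by
  rw [← act_mul, Letter.elt_inv, mul_inv_cancel, act_one]

end Act

namespace PingPong

section Topological

variable {X : Type*} [TopologicalSpace X] {Ψ : Act F2 X} {τ : Letter → X → ℝ}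

lemma inv' (h : PingPong Ψ τ) (s : Letter) (x : X) : τ s.inv (Ψ s.inv.elt x) = -τ s x := by
  rw [h.inv, act_act_inv]

lemma letter_unique (h : PingPong Ψ τ) {s s' : Letter} {x : X} (hs : 0 ≤ τ s x)
    (hs' : 0 ≤ τ s' x) : s' = s := by
  by_contra hne
  exact absurd hs' (not_le.2 (h.disj s s' x (Ne.symm hne) hs))

lemma pos_act (h : PingPong Ψ τ) {s s' : Letter} (hne : s' ≠ s.inv) {x : X} (hx : 0 ≤ τ s' x) :
    0 < τ s (Ψ s.elt x) := by
  have h1 := h.disj s' s.inv x hne hx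
  rw [h.inv] at h1; linarith

lemma ne_inv (h : PingPong Ψ τ) {s s' : Letter} {x : X} (hx : 0 < τ s x)
    (hx' : 0 ≤ τ s' (Ψ s.inv.elt x)) : s' ≠ s.inv := by
  rintro rfl
  rw [h.inv'] at hx'; linarith

lemma act_mem_pingPongSet {x : X} (hx : x ∈ pingPongSet Ψ τ) (g : F2) :
    Ψ g x ∈ pingPongSet Ψ τ := fun g' => by
  rw [← act_mul]; exact hx _

lemma exists_pos_of_mem {x : X} (hx : x ∈ pingPongSet Ψ τ) : ∃ s, 0 < τ s x := by
  simpa [act_one] using hx 1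

/-- A point outside all open regions has a neighbourhood that avoids `pingPongSet Ψ τ`: a nearby
point either is outside all open regions too, or lies in the region of some `s` and leaves all
regions under `s⁻¹`. -/
lemma eventually_notMem (h : PingPong Ψ τ) {x : X} (hx : ∀ s, τ s x ≤ 0) :
    ∀ᶠ y in 𝓝 x, y ∉ pingPongSet Ψ τ := by
  have key : ∀ s, ∀ᶠ y in 𝓝 x, 0 < τ s y → y ∉ pingPongSet Ψ τ := by
    intro s
    rcases (hx s).lt_or_eq with hlt | heq
    · filter_upwards [(h.cont s).continuousAt.eventually_lt_const hlt] with y hy hy'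
      linarith
    · have h0 : 0 ≤ τ s.inv (Ψ s.inv.elt x) := by rw [h.inv', heq, neg_zero]
      have hnear : ∀ᶠ y in 𝓝 x, ∀ s', s' ≠ s.inv → τ s' (Ψ s.inv.elt y) < 0 := by
        rw [eventually_all]
        intro s'
        by_cases hs' : s' = s.inv
        · exact Eventually.of_forall fun y hy => absurd hs' hy
        · have hc : Continuous fun y => τ s' (Ψ s.inv.elt y) :=
            (h.cont s').comp (Ψ s.inv.elt).continuous
          filter_upwards [hc.continuousAt.eventually_lt_const
            (h.disj _ s' _ (Ne.symm hs') h0)] with y hy _ using hy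
      filter_upwards [hnear] with y hy hpos hK
      obtain ⟨s', hs'⟩ := hK s.inv.elt
      have hne := h.ne_inv hpos hs'.le
      linarith [hy s' hne]
  filter_upwards [eventually_all.2 key] with y hy hK
  obtain ⟨s, hs⟩ := exists_pos_of_mem hK
  exact hy s hs hK

lemma isClosed_pingPongSet (h : PingPong Ψ τ) : IsClosed (pingPongSet Ψ τ) := by
  rw [← isOpen_compl_iff, isOpen_iff_mem_nhds]
  intro x hx
  have : ∃ g, ∀ s, τ s (Ψ g x) ≤ 0 := by
    by_contra! hcon; exact hx hcon
  obtain ⟨g, hg⟩ := this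
  filter_upwards [(Ψ g).continuous.continuousAt.eventually (h.eventually_notMem hg)] with y hy hK
  exact hy (act_mem_pingPongSet hK g)

/-- The orbit of every point meets every open region. -/
lemma exists_act_pos (h : PingPong Ψ τ) (s : Letter) (x : X) : ∃ g, 0 < τ s (Ψ g x) := by
  by_cases hx : τ s.inv x < 0
  · exact ⟨s.elt, by have := h.inv s x; linarith⟩
  · obtain ⟨t, ht, ht'⟩ := s.exists_ne
    have ht2 : s.inv ≠ t.inv := fun e => ht (by rw [← t.inv_inv, ← e, s.inv_inv])
    exact ⟨s.elt * t.elt, by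
      rw [act_mul]; exact h.pos_act ht' (h.pos_act ht2 (not_lt.1 hx)).le⟩

/-- A point of the region of `s` that is fixed by `s` lies in `pingPongSet Ψ τ`. -/
lemma fixed_mem (h : PingPong Ψ τ) {s : Letter} {p : X} (hp : 0 < τ s p)
    (hfix : Ψ s.elt p = p) : p ∈ pingPongSet Ψ τ := by
  have hfix' : Ψ s.inv.elt p = p := by
    conv_lhs => rw [← hfix]
    exact act_inv_act Ψ s p
  have key : ∀ L : List Letter, FreeGroup.IsReduced L → Ψ (FreeGroup.mk L) p = p ∨
      ∃ t L', L = t :: L' ∧ 0 < τ t (Ψ (FreeGroup.mk L) p) := by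
    intro L
    induction L with
    | nil => exact fun _ => Or.inl (act_one Ψ p)
    | cons t L ih =>
      intro hL
      rw [Letter.mk_cons, act_mul]
      rcases ih (hL.infix ⟨[t], [], by simp⟩) with h1 | ⟨t', L', rfl, h1⟩
      · rw [h1]
        by_cases h2 : t = s
        · exact Or.inl (by rw [h2, hfix])
        by_cases h3 : s = t.inv
        · have : t = s.inv := by rw [h3, Letter.inv_inv]
          exact Or.inl (by rw [this, hfix'])
        · exact Or.inr ⟨t, L, rfl, h.pos_act h3 hp.le⟩
      · exact Or.inr ⟨t, _, rfl, h.pos_act (Letter.ne_inv_of_isReduced hL) h1.le⟩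
  intro g
  obtain ⟨L, hL, rfl⟩ := Letter.exists_reduced g
  rcases key L hL with h1 | ⟨t, L', -, h1⟩
  · exact ⟨s, by rwa [h1]⟩
  · exact ⟨t, h1⟩

end Topological

section Metric

variable {X : Type*} [MetricSpace X] {Ψ : Act F2 X} {τ : Letter → X → ℝ} {ρ : ℝ}

/-- Points with the same itinerary coincide. The relation `R` expresses that two points lie in a
common region, now and along the whole itinerary. -/
lemma eq_of_same_itinerary [BoundedSpace X] (h : PingPong Ψ τ) (hc : Contracts Ψ τ ρ)
    (hρ0 : 0 ≤ ρ) (hρ1 : ρ < 1) {R : X → X → Prop}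
    (hR : ∀ x y, R x y → ∃ s, 0 < τ s x ∧ 0 < τ s y ∧ R (Ψ s.inv.elt x) (Ψ s.inv.elt y))
    {x y : X} (hxy : R x y) : x = y := by
  obtain ⟨D, hD⟩ := isBounded_iff.1 (Bornology.IsBounded.all (univ : Set X))
  have key : ∀ n : ℕ, ∀ x y, R x y → dist x y ≤ ρ ^ n * D := by
    intro n
    induction n with
    | zero => intro x y _; simpa using hD (mem_univ x) (mem_univ y)
    | succ n ih =>
      intro x y hxy
      obtain ⟨s, hsx, hsy, hR'⟩ := hR x y hxy
      obtain ⟨t, htx, hty, -⟩ := hR _ _ hR'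
      have h1 := hc s t _ _ (h.ne_inv hsx htx.le) htx.le hty.le
      rw [act_act_inv, act_act_inv] at h1
      calc dist x y ≤ ρ * dist (Ψ s.inv.elt x) (Ψ s.inv.elt y) := h1
        _ ≤ ρ * (ρ ^ n * D) := by gcongr; exact ih _ _ hR'
        _ = ρ ^ (n + 1) * D := by ring
  have hlim : Tendsto (fun n : ℕ => ρ ^ n * D) atTop (𝓝 0) := by
    simpa using (tendsto_pow_atTop_nhds_zero_of_lt_one hρ0 hρ1).mul_const D
  exact dist_le_zero.1 (ge_of_tendsto' hlim fun n => key n x y hxy)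

lemma isTotallyDisconnected [BoundedSpace X] (h : PingPong Ψ τ) (hc : Contracts Ψ τ ρ)
    (hρ0 : 0 ≤ ρ) (hρ1 : ρ < 1) : IsTotallyDisconnected (pingPongSet Ψ τ) := by
  intro T hT hTc x hx y hy
  refine h.eq_of_same_itinerary hc hρ0 hρ1
    (R := fun x y => ∃ T ⊆ pingPongSet Ψ τ, IsPreconnected T ∧ x ∈ T ∧ y ∈ T) ?_
    ⟨T, hT, hTc, hx, hy⟩
  rintro x y ⟨T, hT, hTc, hx, hy⟩
  obtain ⟨s, hs⟩ := exists_pos_of_mem (hT hx)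
  have hy' : 0 < τ s y := by
    have hsub := hTc.subset_left_of_subset_union (u := {z | 0 < τ s z}) (v := {z | τ s z < 0})
      (isOpen_lt continuous_const (h.cont s)) (isOpen_lt (h.cont s) continuous_const)
      (disjoint_left.2 fun z (h1 : 0 < τ s z) (h2 : τ s z < 0) => by linarith)
      (fun z hz => by
        obtain ⟨t, ht⟩ := exists_pos_of_mem (hT hz)
        by_cases hts : t = s
        · exact Or.inl (hts ▸ ht)
        · exact Or.inr (h.disj t s z hts ht.le))
      ⟨x, hx, hs⟩
    exact hsub hy
  refine ⟨s, hs, hy', Ψ s.inv.elt '' T, ?_, hTc.image _ (Ψ s.inv.elt).continuous.continuousOn,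
    mem_image_of_mem _ hx, mem_image_of_mem _ hy⟩
  rintro _ ⟨z, hz, rfl⟩
  exact act_mem_pingPongSet (hT hz) _

/-- Every point of `pingPongSet Ψ τ` lies in the image of a region under a group element that
contracts the region as much as one likes. -/
lemma exists_small_image (h : PingPong Ψ τ) (hc : Contracts Ψ τ ρ) (hρ0 : 0 ≤ ρ) (n : ℕ) :
    ∀ (x : X) (t : Letter), x ∈ pingPongSet Ψ τ → 0 < τ t x →
      ∃ (g : F2) (s : Letter) (y : X), 0 < τ s y ∧ Ψ g y = x ∧
        (∀ u, 0 < τ s u → 0 < τ t (Ψ g u)) ∧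
        ∀ u v, 0 < τ s u → 0 < τ s v → dist (Ψ g u) (Ψ g v) ≤ ρ ^ n * dist u v := by
  induction n with
  | zero =>
    intro x t _ ht
    exact ⟨1, t, x, ht, act_one Ψ x, fun u hu => by rwa [act_one],
      fun u v _ _ => by simp⟩
  | succ n ih =>
    intro x t hx ht
    have hx' := act_mem_pingPongSet hx t.inv.elt
    obtain ⟨t', ht'⟩ := exists_pos_of_mem hx'
    have hne := h.ne_inv ht ht'.le
    obtain ⟨g, s, y, hy, hgy, hmaps, hcon⟩ := ih _ t' hx' ht'
    refine ⟨t.elt * g, s, y, hy, by rw [act_mul, hgy, act_act_inv],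
      fun u hu => by rw [act_mul]; exact h.pos_act hne (hmaps u hu).le, fun u v hu hv => ?_⟩
    rw [act_mul, act_mul]
    calc dist (Ψ t.elt (Ψ g u)) (Ψ t.elt (Ψ g v)) ≤ ρ * dist (Ψ g u) (Ψ g v) :=
          hc t t' _ _ hne (hmaps u hu).le (hmaps v hv).le
      _ ≤ ρ * (ρ ^ n * dist u v) := by gcongr; exact hcon u v hu hv
      _ = ρ ^ (n + 1) * dist u v := by ring

lemma exists_image_dist_lt [BoundedSpace X] (h : PingPong Ψ τ) (hc : Contracts Ψ τ ρ)
    (hρ0 : 0 ≤ ρ) (hρ1 : ρ < 1) {x : X} (hx : x ∈ pingPongSet Ψ τ) {r : ℝ} (hr : 0 < r) :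
    ∃ (g : F2) (s : Letter), ∀ u, 0 < τ s u → dist (Ψ g u) x < r := by
  obtain ⟨D, hD⟩ := isBounded_iff.1 (Bornology.IsBounded.all (univ : Set X))
  have hlim : Tendsto (fun n : ℕ => ρ ^ n * D) atTop (𝓝 0) := by
    simpa using (tendsto_pow_atTop_nhds_zero_of_lt_one hρ0 hρ1).mul_const D
  obtain ⟨n, hn⟩ := (hlim.eventually_lt_const hr).exists
  obtain ⟨t, ht⟩ := exists_pos_of_mem hx
  obtain ⟨g, s, y, hy, rfl, -, hcon⟩ := h.exists_small_image hc hρ0 n x t hx ht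
  refine ⟨g, s, fun u hu => (hcon u y hu hy).trans_lt (lt_of_le_of_lt ?_ hn)⟩
  gcongr
  exact hD (mem_univ u) (mem_univ y)

lemma subset_closure_orbit [BoundedSpace X] (h : PingPong Ψ τ) (hc : Contracts Ψ τ ρ)
    (hρ0 : 0 ≤ ρ) (hρ1 : ρ < 1) (x : X) :
    pingPongSet Ψ τ ⊆ closure (range fun g : F2 => Ψ g x) := by
  intro y hy
  rw [Metric.mem_closure_iff]
  intro r hr
  obtain ⟨g, s, hg⟩ := h.exists_image_dist_lt hc hρ0 hρ1 hy hr
  obtain ⟨g', hg'⟩ := h.exists_act_pos s x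
  exact ⟨_, ⟨g * g', rfl⟩, by rw [dist_comm]; simpa [act_mul] using hg _ hg'⟩

lemma isMinimalSet [BoundedSpace X] (h : PingPong Ψ τ) (hc : Contracts Ψ τ ρ)
    (hρ0 : 0 ≤ ρ) (hρ1 : ρ < 1) (hne : (pingPongSet Ψ τ).Nonempty) :
    IsMinimalSet Ψ (pingPongSet Ψ τ) := by
  refine ⟨hne, fun x hx => Subset.antisymm ?_ (h.subset_closure_orbit hc hρ0 hρ1 x)⟩
  refine closure_minimal ?_ h.isClosed_pingPongSet
  rintro _ ⟨g, rfl⟩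
  exact act_mem_pingPongSet hx g

lemma eq_of_isMinimalSet [BoundedSpace X] (h : PingPong Ψ τ) (hc : Contracts Ψ τ ρ)
    (hρ0 : 0 ≤ ρ) (hρ1 : ρ < 1) (hne : (pingPongSet Ψ τ).Nonempty) {M : Set X}
    (hM : IsMinimalSet Ψ M) : M = pingPongSet Ψ τ := by
  obtain ⟨⟨x, hx⟩, hM⟩ := hM
  obtain ⟨y, hy⟩ := hne
  have hyM : y ∈ M := by
    rw [← hM x hx]; exact h.subset_closure_orbit hc hρ0 hρ1 x hy
  rw [← hM y hyM, (h.isMinimalSet hc hρ0 hρ1 ⟨y, hy⟩).2 y hy]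

lemma isCantorSet [CompactSpace X] (h : PingPong Ψ τ) (hc : Contracts Ψ τ ρ)
    (hρ0 : 0 ≤ ρ) (hρ1 : ρ < 1) {p : Letter → X} (hp : ∀ s, 0 < τ s (p s))
    (hfix : ∀ s, Ψ s.elt (p s) = p s) : IsCantorSet (pingPongSet Ψ τ) := by
  have hmem : ∀ s, p s ∈ pingPongSet Ψ τ := fun s => h.fixed_mem (hp s) (hfix s)
  refine ⟨⟨_, hmem (0, true)⟩, h.isClosed_pingPongSet.isCompact,
    h.isTotallyDisconnected hc hρ0 hρ1, fun x hx => ?_⟩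
  rw [accPt_iff_nhds]
  intro U hU
  obtain ⟨r, hr, hrU⟩ := Metric.mem_nhds_iff.1 hU
  obtain ⟨g, s, hg⟩ := h.exists_image_dist_lt hc hρ0 hρ1 hx hr
  -- The region of `s` contains the two points `p s` and `Ψ s (p t)` of the set.
  obtain ⟨t, ht, ht'⟩ := s.exists_ne
  have h1 : p s ≠ Ψ s.elt (p t) := by
    intro e
    rw [← hfix s] at e
    have e' := (Ψ s.elt).injective e
    have := h.disj s t (p s) (Ne.symm ht) (hp s).le
    rw [e'] at this
    linarith [hp t]
  have h2 : 0 < τ s (Ψ s.elt (p t)) := h.pos_act ht' (hp t).le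
  by_cases hx1 : Ψ g (p s) = x
  · refine ⟨Ψ g (Ψ s.elt (p t)), ⟨hrU (hg _ h2),
      act_mem_pingPongSet (act_mem_pingPongSet (hmem t) _) _⟩, fun e => h1 ?_⟩
    exact (Ψ g).injective (hx1.trans e.symm)
  · exact ⟨Ψ g (p s), ⟨hrU (hg _ (hp s)), act_mem_pingPongSet (hmem s) _⟩, hx1⟩

/-- Off the regions, the whole group acts by Lipschitz maps with a common constant: only the
first letter of a reduced word is not a contraction. -/
lemma dist_act_le (h : PingPong Ψ τ) (hc : Contracts Ψ τ ρ) (hρ1 : ρ ≤ 1) {M : ℝ}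
    (hM1 : 1 ≤ M) (hM : ∀ (s : Letter) x y, dist (Ψ s.elt x) (Ψ s.elt y) ≤ M * dist x y) {x y : X}
    (hx : ∀ s, τ s x ≤ 0) (hy : ∀ s, τ s y ≤ 0) (g : F2) :
    dist (Ψ g x) (Ψ g y) ≤ M * dist x y := by
  have key : ∀ L : List Letter, FreeGroup.IsReduced L → L = [] ∨ ∃ s L', L = s :: L' ∧
      0 ≤ τ s (Ψ (FreeGroup.mk L) x) ∧ 0 ≤ τ s (Ψ (FreeGroup.mk L) y) ∧
      dist (Ψ (FreeGroup.mk L) x) (Ψ (FreeGroup.mk L) y) ≤ M * dist x y := by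
    intro L
    induction L with
    | nil => exact fun _ => Or.inl rfl
    | cons s L ih =>
      intro hL
      refine Or.inr ⟨s, L, rfl, ?_⟩
      rw [Letter.mk_cons, act_mul, act_mul]
      rcases ih (hL.infix ⟨[s], [], by simp⟩) with rfl | ⟨t, L', rfl, h1, h2, h3⟩
      · have e : ∀ z, Ψ (FreeGroup.mk []) z = z := act_one Ψ
        rw [e, e]
        exact ⟨by linarith [h.inv s x, hx s.inv], by linarith [h.inv s y, hy s.inv], hM s x y⟩
      · have hne := Letter.ne_inv_of_isReduced hL
        refine ⟨(h.pos_act hne h1).le, (h.pos_act hne h2).le, (hc s t _ _ hne h1 h2).trans ?_⟩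
        exact (mul_le_of_le_one_left dist_nonneg hρ1).trans h3
  obtain ⟨L, hL, rfl⟩ := Letter.exists_reduced g
  rcases key L hL with rfl | ⟨s, L', -, -, -, h3⟩
  · have e : ∀ z, Ψ (FreeGroup.mk []) z = z := act_one Ψ
    rw [e, e]
    exact le_mul_of_one_le_left dist_nonneg hM1
  · exact h3

end Metric

end PingPong

/-! ### Semiconjugacies between ping-pong actions -/

section Semiconj

lemma forall_nonpos_or_exists_pos {Y : Type*} (τ' : Letter → Y → ℝ) (x : Y) :
    (∀ s, τ' s x ≤ 0) ∨ ∃ s, 0 < τ' s x := by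
  by_cases H : ∃ s, 0 < τ' s x
  · exact Or.inr H
  · push Not at H; exact Or.inl H

variable {X : Type*} [MetricSpace X]

open Classical in
/-- The graph transform: `h` is replaced by `Φ s ∘ h ∘ (Ψ s)⁻¹` on the open region of `s` and by
`h₀` outside all regions. Its fixed points are the semiconjugacies that extend `h₀`. -/
noncomputable def graphTransform (Φ Ψ : Act F2 X) (τ' : Letter → X → ℝ) (h₀ h : X → X) (x : X) :
    X :=
  if H : ∃ s, 0 < τ' s x then Φ H.choose.elt (h (Ψ H.choose.inv.elt x)) else h₀ x

/-- The properties of `h : X → X` that are preserved by the graph transform: it extends `h₀`,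
carries the closed regions for `Ψ` into those for `Φ`, and is `ε`-close to the identity. -/
structure IsAdmissible (τ τ' : Letter → X → ℝ) (h₀ : X → X) (ε : ℝ) (h : X → X) : Prop where
  cont : Continuous h
  eq : ∀ x, (∀ s, τ' s x ≤ 0) → h x = h₀ x
  nonneg : ∀ s x, 0 ≤ τ' s x → 0 ≤ τ s (h x)
  close : ∀ x, dist (h x) x ≤ ε

/-- The data for a semiconjugacy from `Ψ` to `Φ`: a map `h₀` that respects the regions and
satisfies the semiconjugacy equation on their boundaries, together with the constants that keep
the graph transform `ε`-close to the identity. -/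
structure SemiconjData (Φ Ψ : Act F2 X) (τ τ' : Letter → X → ℝ) (h₀ : X → X) (ρ ε : ℝ) :
    Prop where
  left : PingPong Φ τ
  right : PingPong Ψ τ'
  cont : Continuous h₀
  sign : ∀ s x, τ s (h₀ x) = τ' s x ∨ (τ s (h₀ x) < 0 ∧ τ' s x < 0)
  compat : ∀ (s : Letter) x, τ' s.inv x = 0 → h₀ (Ψ s.elt x) = Φ s.elt (h₀ x)
  rho_nonneg : 0 ≤ ρ
  rho_lt_one : ρ < 1
  contracts : Contracts Φ τ ρ
  close : ∀ x, dist (h₀ x) x ≤ ε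
  close_base : ∀ (s : Letter) x, dist (Φ s.elt (h₀ x)) (Ψ s.elt x) ≤ ε
  close_step : ∀ (s s' : Letter) x y, s' ≠ s.inv → 0 ≤ τ' s' x → 0 ≤ τ s' y → dist y x ≤ ε →
    dist (Φ s.elt y) (Ψ s.elt x) ≤ ε

namespace SemiconjData

variable {Φ Ψ : Act F2 X} {τ τ' : Letter → X → ℝ} {h₀ h : X → X} {ρ ε : ℝ}

lemma isAdmissible (D : SemiconjData Φ Ψ τ τ' h₀ ρ ε) : IsAdmissible τ τ' h₀ ε h₀ where
  cont := D.cont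
  eq _ _ := rfl
  nonneg s x hx := by rcases D.sign s x with h | h <;> linarith
  close := D.close

lemma graphTransform_of_forall (hx : ∀ s, τ' s x ≤ 0) :
    graphTransform Φ Ψ τ' h₀ h x = h₀ x := by
  rw [graphTransform, dif_neg]
  push Not
  exact hx

lemma graphTransform_of_pos (D : SemiconjData Φ Ψ τ τ' h₀ ρ ε) {s : Letter} {x : X}
    (hx : 0 < τ' s x) :
    graphTransform Φ Ψ τ' h₀ h x = Φ s.elt (h (Ψ s.inv.elt x)) := by
  have H : ∃ s, 0 < τ' s x := ⟨s, hx⟩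
  rw [graphTransform, dif_pos H, D.right.letter_unique hx.le H.choose_spec.le]

lemma forall_nonpos_of_eq_zero (D : SemiconjData Φ Ψ τ τ' h₀ ρ ε) {s : Letter} {x : X}
    (hx : τ' s x = 0) (s' : Letter) : τ' s' x ≤ 0 := by
  by_cases hs : s = s'
  · exact hs ▸ hx.le
  · exact (D.right.disj s s' x hs hx.ge).le

lemma graphTransform_of_nonneg (D : SemiconjData Φ Ψ τ τ' h₀ ρ ε)
    (hh : IsAdmissible τ τ' h₀ ε h) {s : Letter} {x : X} (hx : 0 ≤ τ' s x) :
    graphTransform Φ Ψ τ' h₀ h x = Φ s.elt (h (Ψ s.inv.elt x)) := by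
  rcases hx.lt_or_eq with hlt | heq
  · exact D.graphTransform_of_pos hlt
  · have h0 : τ' s.inv (Ψ s.inv.elt x) = 0 := by rw [D.right.inv', ← heq, neg_zero]
    rw [graphTransform_of_forall (D.forall_nonpos_of_eq_zero heq.symm),
      hh.eq _ (D.forall_nonpos_of_eq_zero h0), ← D.compat s _ h0, act_act_inv]

/-- Outside the closed region of `s`, an admissible map avoids the closed region of `s`. -/
lemma neg_of_neg (D : SemiconjData Φ Ψ τ τ' h₀ ρ ε) (hh : IsAdmissible τ τ' h₀ ε h)
    {s : Letter} {x : X} (hx : τ' s x < 0) : τ s (h x) < 0 := by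
  by_cases H : ∃ t, 0 < τ' t x
  · obtain ⟨t, ht⟩ := H
    refine D.left.disj t s _ ?_ (hh.nonneg t x ht.le)
    rintro rfl; linarith
  · push Not at H
    rw [hh.eq x H]
    rcases D.sign s x with h | h <;> linarith

lemma continuous_graphTransform (D : SemiconjData Φ Ψ τ τ' h₀ ρ ε)
    (hh : IsAdmissible τ τ' h₀ ε h) : Continuous (graphTransform Φ Ψ τ' h₀ h) := by
  -- The closed regions and the common complement of the open ones form a finite closed cover.
  let f : Option Letter → Set X := fun o => o.elim {x | ∀ s, τ' s x ≤ 0} fun s => {x | 0 ≤ τ' s x}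
  refine (locallyFinite_of_finite f).continuous ?_ ?_ ?_
  · refine eq_univ_of_forall fun x => mem_iUnion.2 ?_
    rcases forall_nonpos_or_exists_pos τ' x with hx | ⟨s, hs⟩
    · exact ⟨none, hx⟩
    · exact ⟨some s, hs.le⟩
  · rintro (_ | s)
    · simp only [f, Option.elim, ofPred_forall]
      exact isClosed_iInter fun s => isClosed_le (D.right.cont s) continuous_const
    · exact isClosed_le continuous_const (D.right.cont s)
  · rintro (_ | s)
    · exact D.cont.continuousOn.congr fun x hx => graphTransform_of_forall hx
    · have hc : Continuous fun x => Φ s.elt (h (Ψ s.inv.elt x)) :=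
        (Φ s.elt).continuous.comp (hh.cont.comp (Ψ s.inv.elt).continuous)
      exact hc.continuousOn.congr fun x hx => D.graphTransform_of_nonneg hh hx

lemma isAdmissible_graphTransform (D : SemiconjData Φ Ψ τ τ' h₀ ρ ε)
    (hh : IsAdmissible τ τ' h₀ ε h) : IsAdmissible τ τ' h₀ ε (graphTransform Φ Ψ τ' h₀ h) where
  cont := D.continuous_graphTransform hh
  eq x hx := graphTransform_of_forall hx
  nonneg s x hx := by
    rw [D.graphTransform_of_nonneg hh hx]
    rcases hx.lt_or_eq with hlt | heq
    · have h1 : τ' s.inv (Ψ s.inv.elt x) < 0 := by rw [D.right.inv']; linarith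
      linarith [D.neg_of_neg hh h1, D.left.inv s (h (Ψ s.inv.elt x))]
    · have h0 : τ' s.inv (Ψ s.inv.elt x) = 0 := by rw [D.right.inv', ← heq, neg_zero]
      rw [hh.eq _ (D.forall_nonpos_of_eq_zero h0)]
      rcases D.sign s.inv (Ψ s.inv.elt x) with h2 | h2 <;>
        linarith [D.left.inv s (h₀ (Ψ s.inv.elt x))]
  close x := by
    rcases forall_nonpos_or_exists_pos τ' x with hx | ⟨s, hs⟩
    · rw [graphTransform_of_forall hx]; exact D.close x
    · rw [D.graphTransform_of_pos hs]
      conv_lhs => rw [← act_act_inv Ψ s x, act_inv_act]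
      rcases forall_nonpos_or_exists_pos τ' (Ψ s.inv.elt x) with hy | ⟨t, ht⟩
      · rw [hh.eq _ hy]; exact D.close_base s _
      · exact D.close_step s t _ _ (D.right.ne_inv hs ht.le) ht.le (hh.nonneg t _ ht.le)
          (hh.close _)

/-- The graph transform contracts the uniform distance of admissible maps. -/
lemma dist_graphTransform_le (D : SemiconjData Φ Ψ τ τ' h₀ ρ ε) {h' : X → X}
    (hh : IsAdmissible τ τ' h₀ ε h) (hh' : IsAdmissible τ τ' h₀ ε h') {r : ℝ} (hr : 0 ≤ r)
    (hd : ∀ x, dist (h x) (h' x) ≤ r) (x : X) :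
    dist (graphTransform Φ Ψ τ' h₀ h x) (graphTransform Φ Ψ τ' h₀ h' x) ≤ ρ * r := by
  have hρr : 0 ≤ ρ * r := mul_nonneg D.rho_nonneg hr
  rcases forall_nonpos_or_exists_pos τ' x with hx | ⟨s, hs⟩
  · rw [graphTransform_of_forall hx, graphTransform_of_forall hx, dist_self]; exact hρr
  · rw [D.graphTransform_of_pos hs, D.graphTransform_of_pos hs]
    rcases forall_nonpos_or_exists_pos τ' (Ψ s.inv.elt x) with hy | ⟨t, ht⟩
    · rw [hh.eq _ hy, hh'.eq _ hy, dist_self]; exact hρr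
    · exact (D.contracts s t _ _ (D.right.ne_inv hs ht.le) (hh.nonneg t _ ht.le)
        (hh'.nonneg t _ ht.le)).trans (mul_le_mul_of_nonneg_left (hd _) D.rho_nonneg)

/-- The graph transform has an admissible fixed point, the uniform limit of its iterates. -/
lemma exists_fixed [CompactSpace X] (D : SemiconjData Φ Ψ τ τ' h₀ ρ ε) :
    ∃ h, IsAdmissible τ τ' h₀ ε h ∧ graphTransform Φ Ψ τ' h₀ h = h := by
  obtain ⟨C, hC⟩ := isBounded_iff.1 (Bornology.IsBounded.all (univ : Set X))
  let T := graphTransform Φ Ψ τ' h₀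
  let H : ℕ → X → X := fun n => T^[n] h₀
  have hsucc : ∀ n, H (n + 1) = T (H n) := fun n => Function.iterate_succ_apply' T n h₀
  have hadm : ∀ n, IsAdmissible τ τ' h₀ ε (H n) := by
    intro n
    induction n with
    | zero => exact D.isAdmissible
    | succ n ih => rw [hsucc]; exact D.isAdmissible_graphTransform ih
  have hgeo : ∀ n x, dist (H n x) (H (n + 1) x) ≤ C * ρ ^ n := by
    intro n
    induction n with
    | zero => intro x; simpa using hC (mem_univ _) (mem_univ _)
    | succ n ih =>
      intro x
      have hnn : 0 ≤ C * ρ ^ n := dist_nonneg.trans (ih x)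
      calc dist (H (n + 1) x) (H (n + 1 + 1) x) ≤ ρ * (C * ρ ^ n) := by
            have e : H (n + 1 + 1) x = T (H (n + 1)) x := by rw [hsucc (n + 1)]
            have e' : H (n + 1) x = T (H n) x := by rw [hsucc n]
            rw [e, e']
            exact D.dist_graphTransform_le (hadm n) (hadm (n + 1)) hnn ih x
        _ = C * ρ ^ (n + 1) := by ring
  have hlim : ∀ x, ∃ y, Tendsto (fun n => H n x) atTop (𝓝 y) := fun x =>
    cauchySeq_tendsto_of_complete
      (cauchySeq_of_le_geometric ρ C D.rho_lt_one fun n => hgeo n x)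
  choose h hh using hlim
  have hunif : TendstoUniformly H h atTop := by
    rw [Metric.tendstoUniformly_iff]
    intro r hr
    have hz : Tendsto (fun n : ℕ => C * ρ ^ n / (1 - ρ)) atTop (𝓝 0) := by
      simpa using ((tendsto_pow_atTop_nhds_zero_of_lt_one D.rho_nonneg D.rho_lt_one).const_mul
        C).div_const (1 - ρ)
    filter_upwards [hz.eventually_lt_const hr] with n hn x
    rw [dist_comm]
    exact (dist_le_of_le_geometric_of_tendsto ρ C D.rho_lt_one (fun n => hgeo n x) (hh x)
      n).trans_lt hn
  have hcont : Continuous h := hunif.continuous (Frequently.of_forall fun n => (hadm n).cont)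
  refine ⟨h, ⟨hcont, fun x hx => ?_, fun s x hx => ?_, fun x => ?_⟩, funext fun x => ?_⟩
  · exact tendsto_nhds_unique (hh x) (by simp_rw [(hadm _).eq x hx]; exact tendsto_const_nhds)
  · exact ge_of_tendsto' (((D.left.cont s).tendsto _).comp (hh x)) fun n => (hadm n).nonneg s x hx
  · exact le_of_tendsto' ((hh x).dist tendsto_const_nhds) fun n => (hadm n).close x
  · refine tendsto_nhds_unique ?_ ((tendsto_add_atTop_iff_nat 1).2 (hh x))
    simp_rw [hsucc]
    rcases forall_nonpos_or_exists_pos τ' x with hx | ⟨s, hs⟩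
    · simp only [T, graphTransform_of_forall hx]; exact tendsto_const_nhds
    · simp only [T, D.graphTransform_of_pos hs]
      exact ((Φ s.elt).continuous.tendsto _).comp (hh _)

/-- The data yield a semiconjugacy (up to surjectivity) that extends `h₀` and respects the
regions. -/
theorem exists_semiconj [CompactSpace X] (D : SemiconjData Φ Ψ τ τ' h₀ ρ ε) :
    ∃ h : X → X, Continuous h ∧ (∀ g x, h (Ψ g x) = Φ g (h x)) ∧ (∀ x, dist (h x) x ≤ ε) ∧
      (∀ x, (∀ s, τ' s x ≤ 0) → h x = h₀ x ∧ ∀ s, τ s (h x) ≤ 0) ∧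
      ∀ s x, 0 < τ' s x → 0 < τ s (h x) := by
  obtain ⟨h, hh, hfix⟩ := D.exists_fixed
  have hletter : ∀ (s : Letter) x, h (Ψ s.elt x) = Φ s.elt (h x) := by
    intro s x
    by_cases hx : τ' s.inv x ≤ 0
    · have h1 : 0 ≤ τ' s (Ψ s.elt x) := by linarith [D.right.inv s x]
      conv_lhs => rw [← hfix]
      rw [D.graphTransform_of_nonneg hh h1, act_inv_act]
    · conv_rhs => rw [← hfix]
      rw [D.graphTransform_of_pos (not_le.1 hx), act_act_inv, Letter.inv_inv]
  refine ⟨h, hh.cont, fun g => ?_, hh.close, fun x hx => ⟨hh.eq x hx, fun s => ?_⟩,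
    fun s x hx => ?_⟩
  · induction g using Letter.induction with
    | one => intro x; rw [act_one, act_one]
    | mul s g ih => intro x; rw [act_mul, act_mul, hletter, ih]
  · rw [hh.eq x hx]
    have := hx s
    rcases D.sign s x with h | h <;> linarith
  · rw [← hfix, D.graphTransform_of_pos hx]
    have h1 : τ' s.inv (Ψ s.inv.elt x) < 0 := by rw [D.right.inv']; linarith
    linarith [D.neg_of_neg hh h1, D.left.inv s (h (Ψ s.inv.elt x))]

end SemiconjData

section Consequences

variable {Φ Ψ : Act F2 X} {τ τ' : Letter → X → ℝ} {h₀ h : X → X}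

lemma mem_pingPongSet_iff_of_semiconj (hsemi : ∀ g x, h (Ψ g x) = Φ g (h x))
    (hnonpos : ∀ x, (∀ s, τ' s x ≤ 0) → ∀ s, τ s (h x) ≤ 0)
    (hpos : ∀ s x, 0 < τ' s x → 0 < τ s (h x)) (x : X) :
    h x ∈ pingPongSet Φ τ ↔ x ∈ pingPongSet Ψ τ' := by
  constructor
  · intro hx g
    by_contra! hcon
    obtain ⟨s, hs⟩ := hx g
    rw [← hsemi] at hs
    linarith [hnonpos _ hcon s]
  · intro hx g
    obtain ⟨s, hs⟩ := hx g
    exact ⟨s, by rw [← hsemi]; exact hpos s _ hs⟩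

/-- A semiconjugacy that respects the regions is injective as soon as it is injective outside the
regions and the letters contract the regions for `Ψ`: off `pingPongSet Ψ τ'` every orbit leaves
the regions, and on this set points are determined by their itineraries. -/
lemma injective_of_semiconj [BoundedSpace X] (hΦ : PingPong Φ τ) (hΨ : PingPong Ψ τ') {ρ : ℝ}
    (hc : Contracts Ψ τ' ρ) (hρ0 : 0 ≤ ρ) (hρ1 : ρ < 1)
    (hsemi : ∀ g x, h (Ψ g x) = Φ g (h x))
    (hnonpos : ∀ x, (∀ s, τ' s x ≤ 0) → ∀ s, τ s (h x) ≤ 0)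
    (hpos : ∀ s x, 0 < τ' s x → 0 < τ s (h x))
    (hinj : ∀ x y, (∀ s, τ' s x ≤ 0) → (∀ s, τ' s y ≤ 0) → h x = h y → x = y) :
    Function.Injective h := by
  have hiff := mem_pingPongSet_iff_of_semiconj hsemi hnonpos hpos
  intro x y hxy
  by_cases hx : x ∈ pingPongSet Ψ τ'
  · have hy : y ∈ pingPongSet Ψ τ' := by rwa [← hiff, ← hxy, hiff]
    refine hΨ.eq_of_same_itinerary hc hρ0 hρ1
      (R := fun x y => x ∈ pingPongSet Ψ τ' ∧ y ∈ pingPongSet Ψ τ' ∧ h x = h y) ?_ ⟨hx, hy, hxy⟩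
    rintro x y ⟨hx, hy, hxy⟩
    obtain ⟨s, hs⟩ := PingPong.exists_pos_of_mem hx
    obtain ⟨t, ht⟩ := PingPong.exists_pos_of_mem hy
    have hst : t = s := by
      refine hΦ.letter_unique (hpos s x hs).le ?_
      rw [hxy]; exact (hpos t y ht).le
    subst hst
    exact ⟨t, hs, ht, PingPong.act_mem_pingPongSet hx _, PingPong.act_mem_pingPongSet hy _,
      by rw [hsemi, hsemi, hxy]⟩
  · have : ∃ g, ∀ s, τ' s (Ψ g x) ≤ 0 := by
      by_contra! hcon; exact hx hcon
    obtain ⟨g, hg⟩ := this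
    have hgxy : h (Ψ g x) = h (Ψ g y) := by rw [hsemi, hsemi, hxy]
    refine (Ψ g).injective (hinj _ _ hg (fun s => ?_) hgxy)
    by_contra hs
    have h1 := hpos s _ (not_le.1 hs)
    rw [← hgxy] at h1
    linarith [hnonpos _ hg s]

end Consequences

end Semiconj

/-! ### Surjectivity of maps of the sphere close to the identity -/

/-- A continuous map of the plane that, on a circle around `0`, moves points by less than the
radius has a zero. Otherwise it has a continuous logarithm, and correcting this logarithm along
the circle yields a continuous logarithm of the identity of the circle. -/
theorem exists_zero_of_norm_sub_lt {f : ℂ → ℂ} (hf : Continuous f) {r : ℝ} (hr : 0 < r)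
    (hclose : ∀ z, ‖z‖ = r → ‖f z - z‖ < r) : ∃ z, f z = 0 := by
  by_contra! hne
  obtain ⟨F, ⟨-, hF⟩, -⟩ := Complex.isCoveringMapOn_exp.existsUnique_continuousMap_lifts
    (⟨f, hf⟩ : C(ℂ, ℂ)) (a₀ := 0) (e₀ := Complex.log (f 0)) (Complex.exp_log (hne 0)) hne
  have hF' : ∀ z, Complex.exp (F z) = f z := fun z => congrFun hF z
  let c : ℝ → ℂ := fun θ => r * Complex.exp (θ * Complex.I)
  have hc : Continuous c := by fun_prop
  have hc0 : ∀ θ, c θ ≠ 0 := fun θ =>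
    mul_ne_zero (by exact_mod_cast hr.ne') (Complex.exp_ne_zero _)
  have hcr : ∀ θ, ‖c θ‖ = r := fun θ => by
    simp [c, Complex.norm_exp_ofReal_mul_I, abs_of_pos hr]
  have hslit : ∀ θ, f (c θ) / c θ ∈ Complex.slitPlane := fun θ => by
    refine Complex.mem_slitPlane_of_norm_lt_one (z := f (c θ) / c θ - 1) ?_ |> fun h => by
      simpa using h
    rw [div_sub_one (hc0 θ), norm_div, hcr, div_lt_one hr]
    exact hclose _ (hcr θ)
  let G : ℝ → ℂ := fun θ => F (c θ) - Complex.log (f (c θ) / c θ) - θ * Complex.I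
  have hG : Continuous G := by
    refine (((map_continuous F).comp hc).sub ?_).sub (by fun_prop)
    exact ((hf.comp hc).div hc hc0).clog hslit
  have hexp : ∀ θ, Complex.exp (G θ) = r := fun θ => by
    have h1 : f (c θ) ≠ 0 := hne _
    simp only [G, Complex.exp_sub, hF', Complex.exp_log (div_ne_zero h1 (hc0 θ))]
    rw [div_div_cancel₀ h1]
    exact mul_div_cancel_right₀ _ (Complex.exp_ne_zero _)
  have hconst := Complex.isCoveringMap_exp.const_of_comp hG
    (fun a b => Subtype.ext (by simp only [hexp])) (2 * Real.pi) 0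
  have hc2 : c (2 * Real.pi) = c 0 := by
    simp only [c]; push_cast; rw [Complex.exp_two_pi_mul_I]; simp
  simp only [G, hc2] at hconst
  have : ((2 * Real.pi : ℝ) : ℂ) * Complex.I = 0 := by
    simpa using sub_right_injective.eq_iff.1 hconst
  simp [Real.pi_ne_zero] at this

lemma S2.norm_eq (x : S2) : ‖(x : E3)‖ = 1 := norm_eq_of_mem_sphere x

lemma exists_orthonormalBasis_eq (q : E3) (hq : ‖q‖ = 1) :
    ∃ b : OrthonormalBasis (Fin 3) ℝ E3, b 0 = q := by
  have hv : Orthonormal ℝ (({0} : Set (Fin 3)).domRestrict fun _ => q) := by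
    refine ⟨fun _ => hq, fun i j hij => absurd (Subsingleton.elim i j) hij⟩
  obtain ⟨b, hb⟩ := hv.exists_orthonormalBasis_extension_of_card_eq
    (by simp : Module.finrank ℝ E3 = Fintype.card (Fin 3))
  exact ⟨b, hb 0 rfl⟩

/-- A continuous map of the sphere that is close to the identity is surjective: near a point `q`,
seen in the orthogonal projection along `q`, it is a planar map close to the identity. -/
theorem surjective_of_dist_lt {h : S2 → S2} (hh : Continuous h)
    (hclose : ∀ x, dist (h x) x < 1 / 2) : Function.Surjective h := by
  intro q
  obtain ⟨b, hb⟩ := exists_orthonormalBasis_eq q (S2.norm_eq q)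
  -- The radial retraction of the plane onto the disc of radius `1 / 2`.
  let ret : ℂ → ℂ := fun w => ((max 1 (2 * ‖w‖))⁻¹ : ℝ) • w
  have hret : Continuous ret := by
    refine Continuous.smul (Continuous.inv₀
      (continuous_const.max (continuous_const.mul continuous_norm)) fun w => ?_) continuous_id
    positivity
  have hret_le : ∀ w, ‖ret w‖ ≤ 1 / 2 := fun w => by
    have h0 : (0 : ℝ) < max 1 (2 * ‖w‖) := by positivity
    rw [norm_smul, norm_inv, Real.norm_of_nonneg h0.le, inv_mul_le_iff₀ h0]
    linarith [le_max_right 1 (2 * ‖w‖)]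
  have hret_eq : ∀ w, ‖w‖ = 1 / 2 → ret w = w := fun w hw => by simp [ret, hw]
  -- The inverse of the projection along `q`, defined on this disc.
  let lift : ℂ → E3 := fun w => b.repr.symm !₂[√(1 - ‖ret w‖ ^ 2), (ret w).re, (ret w).im]
  have hlift : ∀ w, lift w ∈ sphere (0 : E3) 1 := fun w => by
    have h1 : ‖ret w‖ ^ 2 ≤ 1 := by nlinarith [hret_le w, norm_nonneg (ret w)]
    rw [mem_sphere_zero_iff_norm, LinearIsometryEquiv.norm_map, EuclideanSpace.norm_eq,
      Real.sqrt_eq_one]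
    simp only [Fin.sum_univ_three, Real.norm_eq_abs, sq_abs, Matrix.cons_val_zero,
      Matrix.cons_val_one, Matrix.cons_val]
    rw [Real.sq_sqrt (by linarith), Complex.sq_norm, Complex.normSq_apply]
    ring
  let L : ℂ → S2 := fun w => ⟨lift w, hlift w⟩
  have hL : Continuous L := by
    refine Continuous.subtype_mk (b.repr.symm.continuous.comp ?_) _
    refine (PiLp.continuous_toLp 2 _).comp (continuous_pi fun i => ?_)
    fin_cases i
    · exact (continuous_const.sub (hret.norm.pow 2)).sqrt
    · exact Complex.continuous_re.comp hret
    · exact Complex.continuous_im.comp hret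
  let proj : E3 → ℂ := fun x => ⟨b.repr x 1, b.repr x 2⟩
  have hproj : Continuous proj := by
    have : proj = fun x => ((b.repr x 1 : ℝ) : ℂ) + (b.repr x 2 : ℝ) * Complex.I := by
      ext x; exact Complex.mk_eq_add_mul_I _ _
    rw [this]; fun_prop
  have hreprL : ∀ w, b.repr (L w : E3) =
      !₂[√(1 - ‖ret w‖ ^ 2), (ret w).re, (ret w).im] := fun w => by simp [L, lift]
  have hdist : ∀ w, (b.repr (h (L w) : E3) 0 - √(1 - ‖ret w‖ ^ 2)) ^ 2 +
      ((b.repr (h (L w) : E3) 1 - (ret w).re) ^ 2 + (b.repr (h (L w) : E3) 2 - (ret w).im) ^ 2)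
        < (1 / 2) ^ 2 := fun w => by
    have h1 := hclose (L w)
    rw [Subtype.dist_eq, dist_eq_norm, ← b.repr.norm_map, map_sub, hreprL,
      EuclideanSpace.norm_eq, Real.sqrt_lt' (by norm_num)] at h1
    simpa [Fin.sum_univ_three, sq_abs, add_assoc] using h1
  obtain ⟨w, hw⟩ := exists_zero_of_norm_sub_lt (f := fun w => proj (h (L w)))
    (hproj.comp (continuous_subtype_val.comp (hh.comp hL))) (r := 1 / 2) (by norm_num)
    (fun w hw => by
      have h1 := hdist w
      rw [hret_eq w hw] at h1
      refine lt_of_pow_lt_pow_left₀ 2 (by norm_num) ?_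
      rw [Complex.sq_norm, Complex.normSq_apply, Complex.sub_re, Complex.sub_im]
      simp only [proj]
      nlinarith [sq_nonneg (b.repr (h (L w) : E3) 0 - √(1 - ‖w‖ ^ 2))])
  -- At a zero of the projected map, the image point is `q` or `-q`, and `-q` is too far away.
  have hw1 : b.repr (h (L w) : E3) 1 = 0 := congrArg Complex.re hw
  have hw2 : b.repr (h (L w) : E3) 2 = 0 := congrArg Complex.im hw
  have hn : b.repr (h (L w) : E3) 0 ^ 2 = 1 := by
    have h1 := S2.norm_eq (h (L w))
    rw [← b.repr.norm_map, EuclideanSpace.norm_eq, Real.sqrt_eq_one] at h1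
    simpa [Fin.sum_univ_three, sq_abs, hw1, hw2] using h1
  have hsq : 1 / 2 ≤ √(1 - ‖ret w‖ ^ 2) := by
    refine Real.le_sqrt_of_sq_le ?_
    nlinarith [hret_le w, norm_nonneg (ret w)]
  have hpos : b.repr (h (L w) : E3) 0 = 1 := by
    rcases mul_self_eq_one_iff.1 ((sq _).symm.trans hn) with h | hneg
    · exact h
    · have h1 := hdist w
      rw [hneg] at h1
      nlinarith [sq_nonneg (b.repr (h (L w) : E3) 1 - (ret w).re),
        sq_nonneg (b.repr (h (L w) : E3) 2 - (ret w).im)]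
  refine ⟨L w, Subtype.ext ?_⟩
  rw [← hb, ← b.sum_repr (h (L w) : E3), Fin.sum_univ_three, hw1, hw2, hpos]
  simp

/-! ### Boosts of the sphere -/

lemma S2.contMDiff_coe : ContMDiff (𝓡 2) 𝓘(ℝ, E3) 1 (Subtype.val : S2 → E3) := by
  have : Fact (Module.finrank ℝ E3 = 2 + 1) := ⟨finrank_euclideanSpace_fin⟩
  exact contMDiff_coe_sphere

lemma S2.contMDiff_of_coe {f : S2 → S2}
    (hf : ContMDiff (𝓡 2) 𝓘(ℝ, E3) 1 fun x => (f x : E3)) : ContMDiff (𝓡 2) (𝓡 2) 1 f := by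
  have : Fact (Module.finrank ℝ E3 = 2 + 1) := ⟨finrank_euclideanSpace_fin⟩
  exact hf.codRestrict_sphere fun x => (f x).2

lemma S2.abs_inner_le (p x : S2) : |inner ℝ (p : E3) (x : E3)| ≤ 1 := by
  simpa [S2.norm_eq] using abs_real_inner_le_norm (p : E3) (x : E3)

lemma S2.dist_sq (x y : S2) : dist x y ^ 2 = 2 - 2 * inner ℝ (x : E3) (y : E3) := by
  rw [Subtype.dist_eq, dist_eq_norm, norm_sub_sq_real, S2.norm_eq, S2.norm_eq]; ring

lemma S2.inner_self (x : S2) : inner ℝ (x : E3) (x : E3) = 1 := by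
  rw [real_inner_self_eq_norm_sq, S2.norm_eq, one_pow]

lemma S2.inner_neg_left (p x : S2) :
    inner ℝ ((-p : S2) : E3) (x : E3) = -inner ℝ (p : E3) (x : E3) := by
  rw [coe_neg_sphere, _root_.inner_neg_left]

/-- The denominator `401 + 399 ⟪p, x⟫` of the boost with pole `p`. -/
noncomputable def boostDen (p x : E3) : ℝ := 401 + 399 * inner ℝ p x

/-- The hyperbolic Möbius transformation of the sphere with sink `p` and source `-p`, the action
on the light cone of the Lorentz boost in the direction `p` with hyperbolic cosine `401 / 40` and
hyperbolic sine `399 / 40`. In the coordinate `tan (r / 2)`, where `r` is the angle to `p`, it is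
the division by `20`. -/
noncomputable def boostVec (p x : E3) : E3 :=
  (boostDen p x)⁻¹ • ((40 : ℝ) • x + (361 * inner ℝ p x + 399) • p)

lemma boostDen_ge (p x : S2) : 2 ≤ boostDen p x := by
  have := (abs_le.1 (S2.abs_inner_le p x)).1
  unfold boostDen; linarith

lemma boostDen_pos (p x : S2) : 0 < boostDen p x := by linarith [boostDen_ge p x]

lemma inner_boostVec_boostVec (p x y : S2) :
    inner ℝ (boostVec p x) (boostVec p y) =
      1 - 1600 * (1 - inner ℝ (x : E3) (y : E3)) / (boostDen p x * boostDen p y) := by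
  have hx := (boostDen_pos p x).ne'
  have hy := (boostDen_pos p y).ne'
  simp only [boostVec, inner_smul_left, inner_smul_right, inner_add_left, inner_add_right,
    S2.inner_self, real_inner_comm (p : E3) (x : E3), conj_trivial]
  field_simp
  simp only [boostDen]
  ring

lemma boostVec_mem (p x : S2) : boostVec p x ∈ sphere (0 : E3) 1 := by
  rw [mem_sphere_zero_iff_norm, ← sq_eq_sq₀ (norm_nonneg _) zero_le_one,
    ← real_inner_self_eq_norm_sq, inner_boostVec_boostVec, S2.inner_self]
  norm_num

lemma inner_boostVec (p x : S2) : inner ℝ (p : E3) (boostVec p x) =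
    (401 * inner ℝ (p : E3) (x : E3) + 399) / boostDen p x := by
  simp only [boostVec, inner_smul_right, inner_add_right, S2.inner_self]
  rw [inv_mul_eq_div]; ring_nf

lemma boostVec_neg_boostVec (p x : S2) : boostVec (-p : S2) (boostVec p x) = x := by
  have hx := (boostDen_pos p x).ne'
  have h1 : boostDen (-p : S2) (boostVec p x) = 1600 / boostDen p x := by
    have h0 : inner ℝ ((-p : S2) : E3) (boostVec p x) = _ :=
      S2.inner_neg_left p ⟨_, boostVec_mem p x⟩
    rw [boostDen, h0]
    simp only
    rw [inner_boostVec, eq_div_iff hx]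
    field_simp
    simp only [boostDen]; ring
  have h0 : inner ℝ ((-p : S2) : E3) (boostVec p x) = _ :=
      S2.inner_neg_left p ⟨_, boostVec_mem p x⟩
  rw [boostVec, h1, h0]
  simp only
  rw [inner_boostVec, inv_div, coe_neg_sphere]
  rw [boostVec]
  match_scalars
  · field_simp
    norm_num
  · field_simp
    simp only [boostDen]
    ring

lemma continuous_boostVec (p : S2) : Continuous fun x : S2 => boostVec p x := by
  unfold boostVec
  refine Continuous.smul (Continuous.inv₀ ?_ fun x => (boostDen_pos p x).ne') (by fun_prop)
  unfold boostDen; fun_prop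

/-- The boost with pole `p` as a homeomorphism of the sphere. -/
noncomputable def boost (p : S2) : S2 ≃ₜ S2 where
  toFun x := ⟨boostVec p x, boostVec_mem p x⟩
  invFun x := ⟨boostVec (-p : S2) x, boostVec_mem (-p) x⟩
  left_inv x := Subtype.ext (boostVec_neg_boostVec p x)
  right_inv x := Subtype.ext (by simpa using boostVec_neg_boostVec (-p) x)
  continuous_toFun := (continuous_boostVec p).subtype_mk _
  continuous_invFun := (continuous_boostVec (-p)).subtype_mk _

lemma boost_coe (p x : S2) : (boost p x : E3) = boostVec p x := rfl

lemma boost_symm (p : S2) : (boost p).symm = boost (-p) :=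
  Homeomorph.ext fun _ => rfl

lemma boost_inv (p : S2) : (boost p)⁻¹ = boost (-p) :=
  Homeomorph.ext fun _ => rfl

lemma boost_boost_neg (p x : S2) : boost p (boost (-p) x) = x := (boost p).apply_symm_apply x

lemma boost_neg_boost (p x : S2) : boost (-p) (boost p x) = x := (boost p).symm_apply_apply x

lemma inner_boost (p x : S2) : inner ℝ (p : E3) (boost p x : E3) =
    (401 * inner ℝ (p : E3) (x : E3) + 399) / boostDen p x := inner_boostVec p x

/-- Möbius transformations are conformal, and the chordal distance is multiplied by the geometric
mean of the conformal factors `40 / boostDen p x` and `40 / boostDen p y`. -/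
lemma dist_boost_sq (p x y : S2) : dist (boost p x) (boost p y) ^ 2 * (boostDen p x * boostDen p y)
    = 1600 * dist x y ^ 2 := by
  rw [S2.dist_sq, S2.dist_sq, boost_coe, boost_coe, inner_boostVec_boostVec]
  have hx := (boostDen_pos p x).ne'
  have hy := (boostDen_pos p y).ne'
  field_simp
  ring

lemma dist_boost_le {p x y : S2} {m : ℝ} (hm : 0 < m) (hx : m ≤ boostDen p x)
    (hy : m ≤ boostDen p y) : dist (boost p x) (boost p y) ≤ 40 / m * dist x y := by
  have h1 := dist_boost_sq p x y
  have h2 : m * m ≤ boostDen p x * boostDen p y := mul_le_mul hx hy hm.le (hm.le.trans hx)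
  have h3 : (dist (boost p x) (boost p y) * m) ^ 2 ≤ (40 * dist x y) ^ 2 := by
    nlinarith [mul_le_mul_of_nonneg_left h2 (sq_nonneg (dist (boost p x) (boost p y)))]
  have h4 := (sq_le_sq₀ (by positivity) (by positivity)).1 h3
  rw [div_mul_eq_mul_div, le_div_iff₀ hm]
  exact h4

lemma dist_boost_lt {p x y : S2} (hxy : x ≠ y) (hx : 80 < boostDen p x)
    (hy : 80 < boostDen p y) : dist (boost p x) (boost p y) < 1 / 2 * dist x y := by
  have hd : 0 < dist x y := dist_pos.2 hxy
  refine (dist_boost_le (m := min (boostDen p x) (boostDen p y))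
    (by rw [lt_min_iff]; constructor <;> linarith) (min_le_left _ _) (min_le_right _ _)).trans_lt ?_
  have : 80 < min (boostDen p x) (boostDen p y) := lt_min hx hy
  refine mul_lt_mul_of_pos_right ?_ hd
  rw [div_lt_div_iff₀ (by linarith) (by norm_num)]
  linarith

/-- The boosts are Lipschitz with the constant `20`. -/
lemma dist_boost_le_twenty (p x y : S2) : dist (boost p x) (boost p y) ≤ 20 * dist x y := by
  have := dist_boost_le (m := 2) (by norm_num) (boostDen_ge p x) (boostDen_ge p y)
  norm_num at this ⊢
  exact this

lemma contMDiff_boost (p : S2) : ContMDiff (𝓡 2) (𝓡 2) 1 (boost p) := by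
  refine S2.contMDiff_of_coe fun x => ?_
  have h0 : ContDiffAt ℝ 1 (fun y : E3 => inner ℝ (p : E3) y) x :=
    contDiffAt_const.inner ℝ contDiffAt_id
  have h1 : ContDiffAt ℝ 1 (boostVec p) (x : E3) := by
    unfold boostVec
    refine ContDiffAt.smul (ContDiffAt.inv ?_ (boostDen_pos p x).ne') ?_
    · unfold boostDen
      exact contDiffAt_const.add (contDiffAt_const.mul h0)
    · exact (ContDiffAt.const_smul (40 : ℝ) contDiffAt_id).add
        (((contDiffAt_const.mul h0).add contDiffAt_const).smul contDiffAt_const)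
  exact h1.contMDiffAt.comp x (S2.contMDiff_coe x)

/-! ### North-south dynamics of a boost -/

lemma one_sub_inner_boost (p x : S2) :
    (1 - inner ℝ (p : E3) (boost p x : E3)) * boostDen p x
      = 2 * (1 - inner ℝ (p : E3) (x : E3)) := by
  have hx := (boostDen_pos p x).ne'
  rw [inner_boost, sub_mul, div_mul_cancel₀ _ hx, boostDen]; ring

lemma one_add_inner_boost (p x : S2) :
    (1 + inner ℝ (p : E3) (boost p x : E3)) * boostDen p x
      = 800 * (1 + inner ℝ (p : E3) (x : E3)) := by
  have hx := (boostDen_pos p x).ne'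
  rw [inner_boost, add_mul, div_mul_cancel₀ _ hx, boostDen]; ring

lemma eq_of_inner_eq_one {p x : S2} (h : inner ℝ (p : E3) (x : E3) = 1) : x = p := by
  have h1 := S2.dist_sq p x
  rw [h] at h1
  exact (dist_eq_zero.1 (pow_eq_zero_iff two_ne_zero |>.1 (h1.trans (by norm_num)))).symm

lemma inner_lt_one {p x : S2} (h : x ≠ p) : inner ℝ (p : E3) (x : E3) < 1 :=
  lt_of_le_of_ne (abs_le.1 (S2.abs_inner_le p x)).2 fun e => h (eq_of_inner_eq_one e)

lemma neg_one_lt_inner {p x : S2} (h : x ≠ -p) : -1 < inner ℝ (p : E3) (x : E3) := by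
  have := inner_lt_one h
  rw [S2.inner_neg_left] at this
  linarith

lemma boost_self (p : S2) : boost p p = p := by
  apply eq_of_inner_eq_one
  rw [inner_boost, S2.inner_self, boostDen, S2.inner_self]; norm_num

lemma boost_neg_self (p : S2) : boost p (-p) = -p := by
  conv_lhs => rw [← boost_self (-p)]
  exact boost_boost_neg p (-p)

lemma tendsto_boost_iterate {p x : S2} (hx : x ≠ -p) :
    Tendsto (fun n : ℕ => (boost p)^[n] x) atTop (𝓝 p) := by
  set z : S2 → ℝ := fun y => inner ℝ (p : E3) (y : E3) with hz
  have hzx : 0 < 1 + z x := by linarith [neg_one_lt_inner hx]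
  -- A boost divides the ratio of `1 - z` and `1 + z` by `400`.
  have key : ∀ n : ℕ, (1 - z ((boost p)^[n] x)) * (1 + z x) * 400 ^ n
      = (1 - z x) * (1 + z ((boost p)^[n] x)) := by
    intro n
    induction n with
    | zero => simp
    | succ n ih =>
      rw [Function.iterate_succ_apply']
      set y := (boost p)^[n] x
      have h1 := one_sub_inner_boost p y
      have h2 := one_add_inner_boost p y
      have h3 := (boostDen_pos p y).ne'
      apply mul_right_cancel₀ h3
      calc (1 - z (boost p y)) * (1 + z x) * 400 ^ (n + 1) * boostDen p y
          = ((1 - z (boost p y)) * boostDen p y) * (1 + z x) * 400 ^ (n + 1) := by ring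
        _ = 800 * ((1 - z y) * (1 + z x) * 400 ^ n) := by rw [h1]; ring
        _ = (1 - z x) * (800 * (1 + z y)) := by rw [ih]; ring
        _ = (1 - z x) * ((1 + z (boost p y)) * boostDen p y) := by rw [h2]
        _ = _ := by ring
  have hz1 : ∀ y, z y ≤ 1 := fun y => (abs_le.1 (S2.abs_inner_le p y)).2
  rw [tendsto_iff_dist_tendsto_zero]
  have hsq : Tendsto (fun n : ℕ => dist ((boost p)^[n] x) p ^ 2) atTop (𝓝 0) := by
    have hlim : Tendsto (fun n : ℕ => 4 * (1 - z x) / (1 + z x) * (1 / 400 : ℝ) ^ n) atTop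
        (𝓝 0) := by
      simpa using (tendsto_pow_atTop_nhds_zero_of_lt_one (r := (1 / 400 : ℝ)) (by norm_num)
        (by norm_num)).const_mul (4 * (1 - z x) / (1 + z x))
    refine squeeze_zero (fun n => sq_nonneg _) (fun n => ?_) hlim
    have hk := key n
    have hd : dist ((boost p)^[n] x) p ^ 2 = 2 * (1 - z ((boost p)^[n] x)) := by
      rw [dist_comm, S2.dist_sq]; ring
    have hpow : (0 : ℝ) < 400 ^ n := by positivity
    rw [hd, div_mul_eq_mul_div, le_div_iff₀ hzx, one_div, inv_pow, ← div_eq_mul_inv,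
      le_div_iff₀ hpow]
    nlinarith [hz1 x, hz1 ((boost p)^[n] x)]
  have := hsq.sqrt
  simpa [Real.sqrt_sq dist_nonneg] using this

lemma inner_lt_inner_boost {p x : S2} (h1 : x ≠ p) (h2 : x ≠ -p) :
    inner ℝ (p : E3) (x : E3) < inner ℝ (p : E3) (boost p x : E3) := by
  have h3 := inner_lt_one h1
  have h4 := neg_one_lt_inner h2
  rw [inner_boost, lt_div_iff₀ (boostDen_pos p x), boostDen]
  nlinarith

lemma inner_le_inner_boost (p x : S2) :
    inner ℝ (p : E3) (x : E3) ≤ inner ℝ (p : E3) (boost p x : E3) := by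
  rw [inner_boost, le_div_iff₀ (boostDen_pos p x), boostDen]
  have := abs_le.1 (S2.abs_inner_le p x)
  nlinarith

lemma isNorthSouth_boost (p : S2) : IsNorthSouth (boost p) (-p) p := by
  refine ⟨fun e => ?_, boost_neg_self p, boost_self p, Subset.antisymm ?_ ?_,
    fun x hx => tendsto_boost_iterate hx, fun x hx => ?_⟩
  · have h1 := S2.inner_neg_left p p
    rw [e, S2.inner_self] at h1
    norm_num at h1
  · -- The height over the equator increases along orbits, so that other points are wandering.
    intro x hx
    by_contra hne
    rw [mem_insert_iff, mem_singleton_iff, not_or] at hne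
    have hlt := inner_lt_inner_boost hne.2 hne.1
    obtain ⟨m, hm1, hm2⟩ := exists_between hlt
    have hc1 : Continuous fun y : S2 => inner ℝ (p : E3) (y : E3) := by fun_prop
    have hc2 : Continuous fun y : S2 => inner ℝ (p : E3) (boost p y : E3) :=
      hc1.comp (boost p).continuous
    obtain ⟨n, hn, y, ⟨y', hy', rfl⟩, hy⟩ := hx
      {y | inner ℝ (p : E3) (y : E3) < m ∧ m < inner ℝ (p : E3) (boost p y : E3)}
      ((hc1.continuousAt.eventually_lt_const hm1).and
        (hc2.continuousAt.eventually_const_lt hm2))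
    have hmono : ∀ k : ℕ, m < inner ℝ (p : E3) ((boost p)^[k + 1] y' : E3) := by
      intro k
      induction k with
      | zero => exact hy'.2
      | succ k ih =>
        rw [Function.iterate_succ_apply']
        exact ih.trans_le (inner_le_inner_boost p _)
    obtain ⟨k, rfl⟩ := Nat.exists_eq_add_of_le' hn
    exact lt_asymm (hmono k) hy.1
  · have hfix : ∀ y, boost p y = y → y ∈ nonwanderingSet (boost p) := fun y hy U hU =>
      ⟨1, le_rfl, y, ⟨y, mem_of_mem_nhds hU, by simpa using hy⟩, mem_of_mem_nhds hU⟩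
    rintro x (rfl | rfl)
    · exact hfix _ (boost_neg_self p)
    · exact hfix _ (boost_self _)
  · rw [boost_symm]
    exact tendsto_boost_iterate (by simpa using hx)

/-! ### A boost in polar coordinates -/

/-- The action of the boosts on the angle to the pole, `t ↦ 2 arctan (tan (t / 2) / 20)`, written
in a form that is visibly smooth on the whole line. -/
noncomputable def polarMap (t : ℝ) : ℝ :=
  t - 2 * Real.arctan (19 * Real.sin t / (21 + 19 * Real.cos t))

lemma polarDen_pos (t : ℝ) : 0 < 21 + 19 * Real.cos t := by linarith [Real.neg_one_le_cos t]

lemma polarDen_pos' (t : ℝ) : 0 < 401 + 399 * Real.cos t := by linarith [Real.neg_one_le_cos t]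

lemma cos_two_arctan (y : ℝ) : Real.cos (2 * Real.arctan y) = (1 - y ^ 2) / (1 + y ^ 2) := by
  have : (1 + y ^ 2 : ℝ) ≠ 0 := by positivity
  rw [Real.cos_two_mul, Real.cos_sq_arctan]; field_simp; ring

lemma sin_two_arctan (y : ℝ) : Real.sin (2 * Real.arctan y) = 2 * y / (1 + y ^ 2) := by
  have h : (0 : ℝ) < 1 + y ^ 2 := by positivity
  rw [Real.sin_two_mul, Real.sin_arctan, Real.cos_arctan, mul_assoc, div_mul_div_comm,
    Real.mul_self_sqrt h.le]
  ring

lemma one_add_polar_sq (t : ℝ) : 1 + (19 * Real.sin t / (21 + 19 * Real.cos t)) ^ 2 =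
    2 * (401 + 399 * Real.cos t) / (21 + 19 * Real.cos t) ^ 2 := by
  have h1 := (polarDen_pos t).ne'
  field_simp
  nlinarith [Real.sin_sq_add_cos_sq t]

lemma cos_two_arctan_polar (t : ℝ) :
    Real.cos (2 * Real.arctan (19 * Real.sin t / (21 + 19 * Real.cos t))) =
      (40 + 399 * Real.cos t + 361 * Real.cos t ^ 2) / (401 + 399 * Real.cos t) := by
  have h1 := (polarDen_pos t).ne'
  have h2 := (polarDen_pos' t).ne'
  rw [cos_two_arctan, one_add_polar_sq, div_eq_div_iff (by positivity) h2, div_pow, mul_pow,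
    Real.sin_sq]
  field_simp
  ring

lemma sin_two_arctan_polar (t : ℝ) :
    Real.sin (2 * Real.arctan (19 * Real.sin t / (21 + 19 * Real.cos t))) =
      19 * Real.sin t * (21 + 19 * Real.cos t) / (401 + 399 * Real.cos t) := by
  have h1 := (polarDen_pos t).ne'
  have h2 := (polarDen_pos' t).ne'
  rw [sin_two_arctan, one_add_polar_sq, div_eq_div_iff (by positivity) h2]
  field_simp

lemma cos_polarMap (t : ℝ) :
    Real.cos (polarMap t) = (401 * Real.cos t + 399) / (401 + 399 * Real.cos t) := by
  rw [polarMap, Real.cos_sub, cos_two_arctan_polar, sin_two_arctan_polar, ← mul_div_assoc,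
    ← mul_div_assoc, ← add_div]
  congr 1
  linear_combination (399 + 361 * Real.cos t) * Real.sin_sq_add_cos_sq t

lemma sin_polarMap (t : ℝ) :
    Real.sin (polarMap t) = 40 * Real.sin t / (401 + 399 * Real.cos t) := by
  rw [polarMap, Real.sin_sub, cos_two_arctan_polar, sin_two_arctan_polar, ← mul_div_assoc,
    ← mul_div_assoc, ← sub_div]
  congr 1
  ring

/-- The value is in `(-π, t]` and its sine is nonnegative. -/
lemma polarMap_mem {t : ℝ} (ht : t ∈ Icc 0 Real.pi) : polarMap t ∈ Icc 0 Real.pi := by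
  have hs := Real.sin_nonneg_of_mem_Icc ht
  have h1 : 0 ≤ Real.arctan (19 * Real.sin t / (21 + 19 * Real.cos t)) :=
    Real.arctan_nonneg.2 (div_nonneg (by positivity) (polarDen_pos t).le)
  refine ⟨?_, by unfold polarMap; linarith [ht.2]⟩
  by_contra hneg
  have h2 : -Real.pi < polarMap t := by
    unfold polarMap
    linarith [ht.1, Real.arctan_lt_pi_div_two (19 * Real.sin t / (21 + 19 * Real.cos t))]
  have h3 := Real.sin_neg_of_neg_of_neg_pi_lt (not_le.1 hneg) h2
  rw [sin_polarMap] at h3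
  exact absurd h3 (not_lt.2 (div_nonneg (by positivity) (polarDen_pos' t).le))

lemma strictMonoOn_polarMap : StrictMonoOn polarMap (Icc 0 Real.pi) := by
  intro s hs t ht hst
  have h1 := Real.strictAntiOn_cos hs ht hst
  rw [← Real.strictAntiOn_cos.lt_iff_gt (polarMap_mem ht) (polarMap_mem hs), cos_polarMap,
    cos_polarMap, div_lt_div_iff₀ (polarDen_pos' t) (polarDen_pos' s)]
  nlinarith

lemma contDiff_polarMap : ContDiff ℝ 1 polarMap := by
  unfold polarMap
  refine contDiff_id.sub (contDiff_const.mul (Real.contDiff_arctan.comp ?_))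
  refine ContDiff.div (contDiff_const.mul Real.contDiff_sin)
    (contDiff_const.add (contDiff_const.mul Real.contDiff_cos)) fun t => (polarDen_pos t).ne'

lemma isRadial_boost (p : S2) : IsRadial (boost p) p polarMap := by
  intro x t u _ hu hpu hx
  have hz : inner ℝ (p : E3) (x : E3) = Real.cos t := by
    rw [hx, inner_add_right, inner_smul_right, inner_smul_right, S2.inner_self, hpu]; ring
  have h2 := (polarDen_pos' t).ne'
  rw [boost_coe, boostVec, boostDen, hz, cos_polarMap, sin_polarMap, hx]
  simp only [smul_add, smul_smul]
  rw [add_right_comm, ← add_smul]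
  congr 2 <;> field_simp
  ring

/-! ### Great circles -/

/-- Every point `y` of the sphere has polar coordinates around every point `x`. -/
lemma exists_polar (x y : S2) : ∃ (u : E3) (θ : ℝ), ‖u‖ = 1 ∧ inner ℝ (x : E3) u = 0 ∧
    θ ∈ Icc 0 Real.pi ∧ (y : E3) = Real.cos θ • (x : E3) + Real.sin θ • u := by
  set z : ℝ := inner ℝ (x : E3) (y : E3) with hz
  have hz1 := abs_le.1 (S2.abs_inner_le x y)
  have hnorm : ‖(y : E3) - z • (x : E3)‖ ^ 2 = 1 - z ^ 2 := by
    rw [norm_sub_sq_real, norm_smul, inner_smul_right, real_inner_comm, ← hz, S2.norm_eq,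
      S2.norm_eq, mul_one, Real.norm_eq_abs, sq_abs]
    ring
  by_cases hs : (y : E3) - z • (x : E3) = 0
  · obtain ⟨b, hb⟩ := exists_orthonormalBasis_eq x (S2.norm_eq x)
    refine ⟨b 1, Real.arccos z, b.norm_eq_one 1, ?_,
      ⟨Real.arccos_nonneg z, Real.arccos_le_pi z⟩, ?_⟩
    · rw [← hb]; exact b.inner_eq_zero (by decide)
    · rw [hs, norm_zero] at hnorm
      rw [Real.cos_arccos hz1.1 hz1.2, Real.sin_arccos, ← hnorm]
      simpa using sub_eq_zero.1 hs
  · have hn := norm_ne_zero_iff.2 hs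
    refine ⟨‖(y : E3) - z • (x : E3)‖⁻¹ • ((y : E3) - z • (x : E3)), Real.arccos z,
      norm_smul_inv_norm hs, ?_, ⟨Real.arccos_nonneg z, Real.arccos_le_pi z⟩, ?_⟩
    · rw [inner_smul_right, inner_sub_right, inner_smul_right, S2.inner_self, ← hz]; simp
    · rw [Real.cos_arccos hz1.1 hz1.2, Real.sin_arccos, ← hnorm, Real.sqrt_sq (norm_nonneg _),
        smul_smul, mul_inv_cancel₀ hn, one_smul, add_sub_cancel]

lemma greatCircle_mem {x u : E3} (hx : ‖x‖ = 1) (hu : ‖u‖ = 1) (hxu : inner ℝ x u = 0) (t : ℝ) :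
    Real.cos t • x + Real.sin t • u ∈ sphere (0 : E3) 1 := by
  rw [mem_sphere_zero_iff_norm, ← sq_eq_sq₀ (norm_nonneg _) zero_le_one, norm_add_sq_real,
    norm_smul, norm_smul, inner_smul_left, inner_smul_right, hxu, hx, hu]
  simp

/-- The closure of an open spherical cap is the closed cap. -/
lemma closure_cap (p : S2) {c : ℝ} (hc : c < 1) :
    closure {x : S2 | c < inner ℝ (p : E3) (x : E3)} =
      {x : S2 | c ≤ inner ℝ (p : E3) (x : E3)} := by
  have hcont : Continuous fun y : S2 => inner ℝ (p : E3) (y : E3) := by fun_prop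
  refine Subset.antisymm (closure_minimal (fun x hx => mem_ofPred.2 (le_of_lt (mem_ofPred.1 hx)))
    (isClosed_le continuous_const hcont)) fun x (hx : c ≤ inner ℝ (p : E3) (x : E3)) => ?_
  rcases hx.lt_or_eq with hlt | heq
  · exact subset_closure hlt
  obtain ⟨u, θ, hu, hpu, hθ, hxθ⟩ := exists_polar p x
  have hcos : ∀ t : ℝ, inner ℝ (p : E3) (Real.cos t • (p : E3) + Real.sin t • u) = Real.cos t := by
    intro t
    rw [inner_add_right, inner_smul_right, inner_smul_right, S2.inner_self, hpu]; ring
  have hcθ : c = Real.cos θ := by rw [heq, hxθ, hcos]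
  have hθ0 : 0 < θ := by
    rcases hθ.1.lt_or_eq with h | h
    · exact h
    · rw [hcθ, ← h, Real.cos_zero] at hc; exact absurd hc (lt_irrefl _)
  let y : ℝ → S2 := fun t => ⟨_, greatCircle_mem (S2.norm_eq p) hu hpu t⟩
  have hy : Continuous y := by
    refine Continuous.subtype_mk ?_ _
    fun_prop
  have hyθ : y θ = x := Subtype.ext hxθ.symm
  rw [← hyθ]
  refine mem_closure_of_tendsto (b := 𝓝[<] θ) (hy.continuousAt.tendsto.mono_left
    nhdsWithin_le_nhds) ?_
  filter_upwards [Ioo_mem_nhdsLT hθ0] with t ht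
  show c < inner ℝ (p : E3) (y t : E3)
  simp only [y]
  rw [hcos, hcθ]
  exact Real.strictAntiOn_cos ⟨ht.1.le, ht.2.le.trans hθ.2⟩ hθ ht.2

/-! ### The ping-pong action -/

/-- The poles of the two generators, two orthogonal unit vectors. -/
noncomputable def axis (i : Fin 2) : S2 := ⟨EuclideanSpace.single i.castSucc 1, by simp⟩

/-- The sink of each letter. -/
noncomputable def pole : Letter → S2
  | (i, true) => axis i
  | (i, false) => -axis i

/-- The action generated by the two boosts whose poles are the points `axis i`. -/
noncomputable def boostAct : Act F2 S2 := FreeGroup.lift fun i => boost (axis i)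

/-- The discs of the two generators. At heights above `24 / 25` the inverse boost expands by more
than `2`, since there `boostDen (-axis i)` is less than `20`; the complement of the preimage of the
closed disc, the region of the inverse letter, consists of heights below `-351 / 449 < -3 / 4`. -/
def boostCap (i : Fin 2) : Set S2 := {x | 24 / 25 < inner ℝ (axis i : E3) (x : E3)}

/-- The functions whose positivity sets are the regions formed from `boostCap` for the action
`Ψ`. -/
noncomputable def regionFun (Ψ : Act F2 S2) : Letter → S2 → ℝ
  | (i, true), x => inner ℝ (axis i : E3) (x : E3) - 24 / 25
  | (i, false), x => 24 / 25 - inner ℝ (axis i : E3) (Ψ (FreeGroup.of i) x : E3)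

lemma boostAct_of (i : Fin 2) : boostAct (FreeGroup.of i) = boost (axis i) :=
  FreeGroup.lift_apply_of

lemma boostAct_elt (s : Letter) : boostAct s.elt = boost (pole s) := by
  rcases s with ⟨i, _ | _⟩
  · show boostAct (FreeGroup.of i)⁻¹ = _
    rw [map_inv, boostAct_of, boost_inv]; rfl
  · exact boostAct_of i

lemma inner_axis (i : Fin 2) (x : S2) : inner ℝ (axis i : E3) (x : E3) = (x : E3) i.castSucc := by
  simp [axis, EuclideanSpace.inner_single_left]

lemma inner_pole_inv (s : Letter) (x : S2) :
    inner ℝ (pole s.inv : E3) (x : E3) = -inner ℝ (pole s : E3) (x : E3) := by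
  rcases s with ⟨i, _ | _⟩
  · show inner ℝ (axis i : E3) _ = -inner ℝ ((-axis i : S2) : E3) _
    rw [S2.inner_neg_left, neg_neg]
  · exact S2.inner_neg_left _ _

lemma inner_pole_sq_add_le {s s' : Letter} (h : s.1 ≠ s'.1) (x : S2) :
    inner ℝ (pole s : E3) (x : E3) ^ 2 + inner ℝ (pole s' : E3) (x : E3) ^ 2 ≤ 1 := by
  have hsq : ∀ t : Letter, inner ℝ (pole t : E3) (x : E3) ^ 2 = (x : E3) t.1.castSucc ^ 2 := by
    rintro ⟨i, _ | _⟩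
    · show inner ℝ ((-axis i : S2) : E3) _ ^ 2 = _
      rw [S2.inner_neg_left, neg_sq, inner_axis]
    · show inner ℝ (axis i : E3) _ ^ 2 = _
      rw [inner_axis]
  have hx : (x : E3) 0 ^ 2 + (x : E3) 1 ^ 2 + (x : E3) 2 ^ 2 = 1 := by
    have h1 := S2.norm_eq x
    rw [EuclideanSpace.norm_eq, Real.sqrt_eq_one] at h1
    simpa [Fin.sum_univ_three, sq_abs] using h1
  have h2 := sq_nonneg ((x : E3) 2)
  rw [hsq, hsq]
  rcases s with ⟨i, b⟩
  rcases s' with ⟨j, b'⟩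
  fin_cases i <;> fin_cases j
  · exact absurd rfl h
  · show (x : E3) 0 ^ 2 + (x : E3) 1 ^ 2 ≤ 1
    linarith
  · show (x : E3) 1 ^ 2 + (x : E3) 0 ^ 2 ≤ 1
    linarith
  · exact absurd rfl h

/-- The caps of height `3 / 4` around the sinks of the four letters are disjoint. -/
lemma inner_pole_lt {s s' : Letter} (h : s ≠ s') {x : S2}
    (hx : 3 / 4 ≤ inner ℝ (pole s : E3) (x : E3)) : inner ℝ (pole s' : E3) (x : E3) < 3 / 4 := by
  rcases Letter.eq_or_eq_inv_or_fst_ne s s' with rfl | rfl | h'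
  · exact absurd rfl h
  · rw [inner_pole_inv]; linarith
  · by_contra! hx'
    nlinarith [inner_pole_sq_add_le h' x]

lemma le_boostDen_of_fst_ne {s s' : Letter} (h : s'.1 ≠ s.1) {x : S2}
    (hx : 3 / 4 ≤ inner ℝ (pole s' : E3) (x : E3)) : 120 ≤ boostDen (pole s) x := by
  have h1 := inner_pole_sq_add_le h x
  have h2 : -(2 / 3) ≤ inner ℝ (pole s : E3) (x : E3) :=
    (abs_le.1 (abs_le_of_sq_le_sq (by nlinarith) (by norm_num))).1
  unfold boostDen; linarith

/-- A conformal factor `40 / boostDen` of at most `1 / 3` on the caps of the letters other than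
the inverse. -/
lemma le_boostDen {s s' : Letter} (h : s' ≠ s.inv) {x : S2}
    (hx : 3 / 4 ≤ inner ℝ (pole s' : E3) (x : E3)) : 120 ≤ boostDen (pole s) x := by
  rcases Letter.eq_or_eq_inv_or_fst_ne s s' with rfl | rfl | h'
  · unfold boostDen; linarith
  · exact absurd rfl h
  · exact le_boostDen_of_fst_ne h' hx

lemma dist_boostAct_le {s s' : Letter} (h : s' ≠ s.inv) {x y : S2}
    (hx : 3 / 4 ≤ inner ℝ (pole s' : E3) (x : E3)) (hy : 3 / 4 ≤ inner ℝ (pole s' : E3) (y : E3)) :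
    dist (boostAct s.elt x) (boostAct s.elt y) ≤ 1 / 2 * dist x y := by
  rw [boostAct_elt]
  refine (dist_boost_le (m := 80) (by norm_num) ?_ ?_).trans_eq (by norm_num) <;>
  linarith [le_boostDen h hx, le_boostDen h hy]

lemma dist_boostAct_le_twenty (s : Letter) (x y : S2) :
    dist (boostAct s.elt x) (boostAct s.elt y) ≤ 20 * dist x y := by
  rw [boostAct_elt]; exact dist_boost_le_twenty _ _ _

/-! ### Regions of actions close to the ping-pong action -/

/-- Every letter acts under `Ψ` by a map `δ`-close to the corresponding boost. -/
def IsClose (δ : ℝ) (Ψ : Act F2 S2) : Prop :=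
  ∀ (s : Letter) x, dist (Ψ s.elt x) (boostAct s.elt x) ≤ δ

lemma isClose_boostAct {δ : ℝ} (hδ : 0 ≤ δ) : IsClose δ boostAct := fun s x => by
  rwa [dist_self]

lemma isClose_of_actDist0_lt {δ : ℝ} {Ψ : Act F2 S2} (hδ : 0 ≤ δ)
    (h : actDist0 symGen Ψ boostAct < ENNReal.ofReal δ) : IsClose δ Ψ := by
  intro s x
  rw [← ENNReal.ofReal_le_ofReal_iff hδ, ← edist_dist]
  refine le_trans ?_ h.le
  refine le_trans ?_ (le_iSup₂ (f := fun s (_ : s ∈ symGen) => dC0 (Ψ s) (boostAct s)) s.elt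
    (mem_range_self s))
  exact le_iSup (fun x => edist (Ψ s.elt x) (boostAct s.elt x)) x

lemma IsClose.mono {δ δ' : ℝ} {Ψ : Act F2 S2} (h : IsClose δ Ψ) (hδ : δ ≤ δ') : IsClose δ' Ψ :=
  fun s x => (h s x).trans hδ

lemma IsClose.dist_generator_le {δ : ℝ} {Ψ : Act F2 S2} (h : IsClose δ Ψ) (i : Fin 2) (x : S2) :
    dist (Ψ (FreeGroup.of i) x) (boost (axis i) x) ≤ δ := by
  have := h (i, true) x
  rwa [boostAct_elt] at this

lemma abs_inner_sub_inner_le (p x y : S2) :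
    |inner ℝ (p : E3) (x : E3) - inner ℝ (p : E3) (y : E3)| ≤ dist x y := by
  rw [← inner_sub_right, Subtype.dist_eq, dist_eq_norm]
  simpa [S2.norm_eq] using abs_real_inner_le_norm (p : E3) ((x : E3) - y)

lemma continuous_regionFun (Ψ : Act F2 S2) (s : Letter) : Continuous (regionFun Ψ s) := by
  have hc : ∀ i, Continuous fun y : S2 => inner ℝ (axis i : E3) (y : E3) := fun i => by fun_prop
  rcases s with ⟨i, _ | _⟩
  · exact continuous_const.sub ((hc i).comp (Ψ (FreeGroup.of i)).continuous)
  · exact (hc i).sub continuous_const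

lemma regionFun_inv (Ψ : Act F2 S2) (s : Letter) (x : S2) :
    regionFun Ψ s.inv x = -regionFun Ψ s (Ψ s.elt x) := by
  rcases s with ⟨i, _ | _⟩
  · have h : Ψ (FreeGroup.of i) (Ψ (FreeGroup.of i)⁻¹ x) = x := act_act_inv Ψ (i, true) x
    show inner ℝ (axis i : E3) (x : E3) - 24 / 25 =
      -(24 / 25 - inner ℝ (axis i : E3) (Ψ (FreeGroup.of i) (Ψ (FreeGroup.of i)⁻¹ x) : E3))
    rw [h]; ring
  · show 24 / 25 - inner ℝ (axis i : E3) (Ψ (FreeGroup.of i) x : E3) =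
      -(inner ℝ (axis i : E3) (Ψ (FreeGroup.of i) x : E3) - 24 / 25)
    ring

/-- For a perturbed action, too, the closed region of a letter lies in the cap around its pole on
which the estimates for the boosts hold. -/
lemma IsClose.le_inner_pole {Ψ : Act F2 S2} (h : IsClose (1 / 200) Ψ) {s : Letter} {x : S2}
    (hx : 0 ≤ regionFun Ψ s x) : 3 / 4 ≤ inner ℝ (pole s : E3) (x : E3) := by
  rcases s with ⟨i, _ | _⟩
  · change 0 ≤ 24 / 25 - inner ℝ (axis i : E3) (Ψ (FreeGroup.of i) x : E3) at hx
    show 3 / 4 ≤ inner ℝ ((-axis i : S2) : E3) (x : E3)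
    have h1 := (abs_le.1 ((abs_inner_sub_inner_le (axis i) _ _).trans (h.dist_generator_le i x))).1
    have h2 : inner ℝ (axis i : E3) (boost (axis i) x : E3) ≤ 24 / 25 + 1 / 200 := by linarith
    rw [inner_boost, div_le_iff₀ (boostDen_pos _ _), boostDen] at h2
    rw [S2.inner_neg_left]
    linarith
  · change 0 ≤ inner ℝ (axis i : E3) (x : E3) - 24 / 25 at hx
    show 3 / 4 ≤ inner ℝ (axis i : E3) (x : E3)
    linarith

lemma IsClose.regionFun_neg {Ψ : Act F2 S2} (h : IsClose (1 / 200) Ψ) {s : Letter} {x : S2}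
    (hx : inner ℝ (pole s : E3) (x : E3) < 3 / 4) : regionFun Ψ s x < 0 := by
  by_contra! hcon
  exact absurd (h.le_inner_pole hcon) (not_le.2 hx)

/-- For the unperturbed action the regions are smaller: the gap between the heights `3 / 4` and
`77 / 100` leaves room for a small displacement. -/
lemma regionFun_boostAct_neg {s : Letter} {x : S2}
    (hx : inner ℝ (pole s : E3) (x : E3) < 77 / 100) : regionFun boostAct s x < 0 := by
  rcases s with ⟨i, _ | _⟩
  · change inner ℝ ((-axis i : S2) : E3) (x : E3) < _ at hx
    show 24 / 25 - inner ℝ (axis i : E3) (boostAct (FreeGroup.of i) x : E3) < 0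
    rw [S2.inner_neg_left] at hx
    rw [boostAct_of, inner_boost, sub_neg, lt_div_iff₀ (boostDen_pos _ _), boostDen]
    linarith
  · change inner ℝ (axis i : E3) (x : E3) < _ at hx
    show inner ℝ (axis i : E3) (x : E3) - 24 / 25 < 0
    linarith

lemma IsClose.pingPong {Ψ : Act F2 S2} (h : IsClose (1 / 200) Ψ) :
    PingPong Ψ (regionFun Ψ) where
  cont := continuous_regionFun Ψ
  inv := regionFun_inv Ψ
  disj _ _ _ hss' hx := h.regionFun_neg (inner_pole_lt hss' (h.le_inner_pole hx))

lemma pingPong_boostAct : PingPong boostAct (regionFun boostAct) :=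
  (isClose_boostAct (by norm_num)).pingPong

lemma inner_pole_ge_of_nonneg {s : Letter} {x : S2} (hx : 0 ≤ regionFun boostAct s x) :
    3 / 4 ≤ inner ℝ (pole s : E3) (x : E3) :=
  (isClose_boostAct (by norm_num)).le_inner_pole hx

lemma contracts_boostAct : Contracts boostAct (regionFun boostAct) (1 / 2) :=
  fun _ _ _ _ h hx hy =>
    dist_boostAct_le h (inner_pole_ge_of_nonneg hx) (inner_pole_ge_of_nonneg hy)

lemma region_eq (Ψ : Act F2 S2) (s : Letter) :
    region Ψ boostCap s = {x | 0 < regionFun Ψ s x} := by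
  rcases s with ⟨i, _ | _⟩
  · have h1 : closure (Ψ (FreeGroup.of i) ⁻¹' boostCap i) =
        Ψ (FreeGroup.of i) ⁻¹' {x : S2 | 24 / 25 ≤ inner ℝ (axis i : E3) (x : E3)} := by
      rw [← Homeomorph.preimage_closure]
      exact congrArg _ (closure_cap (axis i) (by norm_num))
    ext x
    show x ∈ (closure (Ψ (FreeGroup.of i) ⁻¹' boostCap i))ᶜ ↔
      0 < 24 / 25 - inner ℝ (axis i : E3) (Ψ (FreeGroup.of i) x : E3)
    rw [h1, mem_compl_iff, mem_preimage, mem_ofPred_eq, not_le, sub_pos]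
  · ext x
    show 24 / 25 < inner ℝ (axis i : E3) (x : E3) ↔ 0 < inner ℝ (axis i : E3) (x : E3) - 24 / 25
    exact sub_pos.symm

lemma limitSet_eq (Ψ : Act F2 S2) : limitSet Ψ boostCap = pingPongSet Ψ (regionFun Ψ) := by
  have hmem : ∀ x, x ∈ level Ψ boostCap 0 ↔ ∃ s, 0 < regionFun Ψ s x := fun x => by
    simp only [level, mem_iUnion, region_eq, mem_ofPred_eq]
  refine Subset.antisymm (fun x hx => ?_) (subset_iInter fun n => ?_)
  · have hletter : ∀ (s : Letter) x, x ∈ limitSet Ψ boostCap → Ψ s.elt x ∈ limitSet Ψ boostCap := by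
      intro s x hx
      refine mem_iInter.2 fun n => ?_
      obtain ⟨y, hy, hyx⟩ := mem_iInter.1 (mem_iInter.1 hx (n + 1)).1 s.inv
      rw [← hyx, act_act_inv]
      exact hy
    have hall : ∀ g, Ψ g x ∈ limitSet Ψ boostCap := fun g => by
      induction g using Letter.induction with
      | one => rwa [act_one]
      | mul s g ih => rw [act_mul]; exact hletter s _ ih
    exact fun g => (hmem _).1 (mem_iInter.1 (hall g) 0)
  · induction n with
    | zero => exact fun x hx => (hmem x).2 (PingPong.exists_pos_of_mem hx)
    | succ n ih =>
      refine fun x hx => ⟨mem_iInter.2 fun s => ?_, ih hx⟩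
      exact ⟨_, ih (PingPong.act_mem_pingPongSet hx s.inv.elt), act_act_inv Ψ s x⟩

lemma le_inner_pole_of_mem_region {s : Letter} {x : S2} (hx : x ∈ region boostAct boostCap s) :
    3 / 4 ≤ inner ℝ (pole s : E3) (x : E3) := by
  rw [region_eq] at hx
  exact inner_pole_ge_of_nonneg (le_of_lt hx)

theorem isPingPong_boostAct : IsPingPong boostAct boostCap where
  diffeo := by
    rintro _ ⟨s, rfl⟩
    rw [boostAct_elt]
    exact contMDiff_boost _
  pole i := by
    have hcos : Real.cos (Real.arccos (24 / 25)) = 24 / 25 :=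
      Real.cos_arccos (by norm_num) (by norm_num)
    refine ⟨axis i, polarMap, Real.arccos (24 / 25), strictMonoOn_polarMap,
      contDiff_polarMap.contDiffOn, by simp [polarMap], by simp [polarMap], ?_, ⟨?_, ?_⟩, ?_,
      ?_, ?_⟩
    · rw [boostAct_of]; exact isRadial_boost _
    · exact Real.arccos_pos.2 (by norm_num)
    · rw [Real.arccos]
      linarith [Real.arcsin_pos.2 (by norm_num : (0 : ℝ) < 24 / 25), Real.pi_pos]
    · rw [hcos]; rfl
    · rw [boostAct_of]; exact isNorthSouth_boost _
    · rw [region_eq]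
      show 0 < 24 / 25 - inner ℝ (axis i : E3) (boostAct (FreeGroup.of i) (-axis i) : E3)
      rw [boostAct_of, boost_neg_self, real_inner_comm, S2.inner_neg_left, S2.inner_self]
      norm_num
  disjoint s s' h := by
    have hcl : ∀ s x, x ∈ closure (region boostAct boostCap s) → 0 ≤ regionFun boostAct s x := by
      intro s
      rw [region_eq]
      exact fun x hx => closure_minimal (fun y hy => le_of_lt hy)
        (isClosed_le continuous_const (continuous_regionFun _ s)) hx
    exact disjoint_left.2 fun x hx hx' =>
      absurd (hcl s' x hx') (not_le.2 (pingPong_boostAct.disj s s' x h (hcl s x hx)))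
  expand i x hx y hy hxy := by
    have hden : ∀ z ∈ region boostAct boostCap (i, true), boostDen (-axis i : S2) z < 20 := by
      intro z hz
      have hz' : 24 / 25 < inner ℝ (axis i : E3) (z : E3) := hz
      rw [boostDen, S2.inner_neg_left]
      linarith
    have h1 := dist_boost_sq (-axis i) x y
    have hd := dist_pos.2 hxy
    have h2 : boostDen (-axis i : S2) x * boostDen (-axis i : S2) y < 20 * 20 :=
      mul_lt_mul'' (hden x hx) (hden y hy) (boostDen_pos _ _).le (boostDen_pos _ _).le
    have h0 : boostAct (FreeGroup.of i)⁻¹ = boost (-axis i) := boostAct_elt (i, false)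
    rw [h0]
    have hd' : 0 < dist (boost (-axis i) x) (boost (-axis i) y) :=
      dist_pos.2 ((boost _).injective.ne hxy)
    refine lt_of_pow_lt_pow_left₀ 2 hd'.le ?_
    nlinarith [mul_lt_mul_of_pos_left h2 (pow_pos hd' 2)]
  contract_self s x hx y hy hxy := by
    rw [boostAct_elt]
    have hs : s ≠ s.inv := s.inv_ne.symm
    refine dist_boost_lt hxy ?_ ?_
    · linarith [le_boostDen hs (le_inner_pole_of_mem_region hx)]
    · linarith [le_boostDen hs (le_inner_pole_of_mem_region hy)]
  contract_cross s j hj x hx y hy hxy := by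
    rw [boostAct_elt]
    have hden : ∀ z ∈ region boostAct boostCap (j, true) ∪ region boostAct boostCap (j, false),
        80 < boostDen (pole s) z := by
      rintro z (hz | hz)
      · linarith [le_boostDen_of_fst_ne (s' := (j, true)) hj (le_inner_pole_of_mem_region hz)]
      · linarith [le_boostDen_of_fst_ne (s' := (j, false)) hj (le_inner_pole_of_mem_region hz)]
    exact dist_boost_lt hxy (hden x hx) (hden y hy)
  ping_pong s s' h := by
    rintro _ ⟨x, hx, rfl⟩
    rw [region_eq] at hx ⊢
    exact pingPong_boostAct.pos_act h (le_of_lt hx)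

lemma pole_mem_region (s : Letter) : 0 < regionFun boostAct s (pole s) := by
  rcases s with ⟨i, _ | _⟩
  · show 0 < 24 / 25 - inner ℝ (axis i : E3) (boostAct (FreeGroup.of i) (-axis i) : E3)
    rw [boostAct_of, boost_neg_self, real_inner_comm, S2.inner_neg_left, S2.inner_self]
    norm_num
  · show 0 < inner ℝ (axis i : E3) (axis i : E3) - 24 / 25
    rw [S2.inner_self]; norm_num

lemma isCantorSet_boostAct : IsCantorSet (pingPongSet boostAct (regionFun boostAct)) :=
  pingPong_boostAct.isCantorSet contracts_boostAct (by norm_num) (by norm_num) pole_mem_region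
    fun s => by rw [boostAct_elt, boost_self]

/-- Two distinct nearby points outside the regions stay close under the whole group. -/
lemma not_isExpansive_boostAct : ¬ IsExpansive boostAct := by
  rintro ⟨α, hα, hexp⟩
  -- The points are taken on a great circle through the point orthogonal to the two axes.
  let e : E3 := EuclideanSpace.single 2 1
  have he : ‖e‖ = 1 := by simp [e]
  have hea : inner ℝ e (axis 0 : E3) = 0 := by simp [e, axis, EuclideanSpace.inner_single_left]
  let c : ℝ → S2 := fun t => ⟨_, greatCircle_mem he (S2.norm_eq (axis 0)) hea t⟩
  have hc0 : ∀ t, (c t : E3) 0 = Real.sin t := fun t => by simp [c, e, axis]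
  have hc1 : ∀ t, (c t : E3) 1 = 0 := fun t => by simp [c, e, axis]
  have hinner : ∀ t, |Real.sin t| ≤ 1 / 2 → ∀ s, regionFun boostAct s (c t) ≤ 0 := by
    intro t ht s
    refine (regionFun_boostAct_neg ?_).le
    have h1 : ∀ i, |inner ℝ (axis i : E3) (c t : E3)| ≤ 1 / 2 := by
      intro i
      rw [inner_axis]
      fin_cases i
      · show |(c t : E3) 0| ≤ _
        rwa [hc0]
      · show |(c t : E3) 1| ≤ _
        rw [hc1]; norm_num
    rcases s with ⟨i, _ | _⟩
    · show inner ℝ ((-axis i : S2) : E3) _ < _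
      rw [S2.inner_neg_left]; linarith [(abs_le.1 (h1 i)).1]
    · show inner ℝ (axis i : E3) _ < _
      linarith [(abs_le.1 (h1 i)).2]
  set t : ℝ := min (1 / 2) (α / 20) with ht
  have ht0 : 0 < t := lt_min (by norm_num) (by positivity)
  have ht1 : t ≤ 1 / 2 := min_le_left _ _
  have ht2 : t ≤ α / 20 := min_le_right _ _
  have hsin : 0 < Real.sin t := Real.sin_pos_of_pos_of_lt_pi ht0 (by linarith [Real.pi_gt_three])
  have hne : c t ≠ c 0 := fun h => by
    have h1 := hc0 t
    rw [h, hc0, Real.sin_zero] at h1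
    linarith
  have hdist : dist (c t) (c 0) ≤ t := by
    refine le_of_sq_le_sq ?_ ht0.le
    have : inner ℝ (c t : E3) (c 0 : E3) = Real.cos t := by
      have hea' : inner ℝ (axis 0 : E3) e = 0 := by rw [real_inner_comm]; exact hea
      simp [c, inner_add_left, inner_smul_left, hea', he]
    rw [S2.dist_sq, this]
    linarith [Real.one_sub_sq_div_two_le_cos (x := t)]
  obtain ⟨g, hg⟩ := hexp _ _ hne
  have hle := pingPong_boostAct.dist_act_le contracts_boostAct (by norm_num) (M := 20) (by norm_num)
    dist_boostAct_le_twenty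
    (hinner t (by rw [abs_of_pos hsin]; linarith [Real.sin_le ht0.le]))
    (hinner 0 (by simp)) g
  linarith

/-! ### The semiconjugacy outside the regions -/

/-- A Lipschitz cut-off function, equal to `1` below `-3 / 4` and to `0` above `-18 / 25`. -/
noncomputable def cutoff (z : ℝ) : ℝ := max 0 (min 1 (100 / 3 * (-(18 / 25) - z)))

lemma cutoff_nonneg (z : ℝ) : 0 ≤ cutoff z := le_max_left _ _

lemma cutoff_le_one (z : ℝ) : cutoff z ≤ 1 := max_le zero_le_one (min_le_left _ _)

lemma cutoff_eq_one {z : ℝ} (h : z ≤ -(3 / 4)) : cutoff z = 1 := by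
  rw [cutoff, min_eq_left (by linarith), max_eq_right zero_le_one]

lemma cutoff_eq_zero {z : ℝ} (h : -(18 / 25) ≤ z) : cutoff z = 0 := by
  rw [cutoff, max_eq_left]
  exact (min_le_right _ _).trans (by linarith)

lemma abs_cutoff_sub_le (z w : ℝ) : |cutoff z - cutoff w| ≤ 100 / 3 * |z - w| := by
  unfold cutoff
  have h1 := (abs_max_sub_max_le_max 0 (min 1 (100 / 3 * (-(18 / 25) - z))) 0
    (min 1 (100 / 3 * (-(18 / 25) - w)))).trans (max_le (by simp) le_rfl)
  have h2 := (abs_min_sub_min_le_max 1 (100 / 3 * (-(18 / 25) - z)) 1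
    (100 / 3 * (-(18 / 25) - w))).trans (max_le (by simp) le_rfl)
  refine h1.trans (h2.trans_eq ?_)
  rw [← mul_sub, abs_mul, sub_sub_sub_cancel_left, abs_sub_comm w z]
  norm_num

lemma continuous_cutoff : Continuous cutoff := by unfold cutoff; fun_prop

/-- The displacement `Φ⁻¹ Ψ x - x` for the `i`-th generator. -/
noncomputable def displacement (Ψ : Act F2 S2) (i : Fin 2) (x : S2) : E3 :=
  (boost (-axis i) (Ψ (FreeGroup.of i) x) : E3) - x

/-- The point `x`, moved towards `Φ⁻¹ Ψ x` near the region of the inverse of each generator. -/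
noncomputable def preInitial (Ψ : Act F2 S2) (x : S2) : E3 :=
  x + ∑ i, cutoff (inner ℝ (axis i : E3) (x : E3)) • displacement Ψ i x

lemma IsClose.norm_displacement_le {δ : ℝ} {Ψ : Act F2 S2} (h : IsClose δ Ψ) (i : Fin 2)
    (x : S2) : ‖displacement Ψ i x‖ ≤ 20 * δ := by
  have h1 := dist_boost_le_twenty (-axis i) (Ψ (FreeGroup.of i) x) (boost (axis i) x)
  rw [boost_neg_boost, Subtype.dist_eq, dist_eq_norm] at h1
  have h2 := h.dist_generator_le i x
  exact h1.trans (by linarith)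

lemma continuous_displacement (Ψ : Act F2 S2) (i : Fin 2) : Continuous (displacement Ψ i) :=
  (continuous_subtype_val.comp ((boost (-axis i)).continuous.comp
    (Ψ (FreeGroup.of i)).continuous)).sub continuous_subtype_val

lemma continuous_preInitial (Ψ : Act F2 S2) : Continuous (preInitial Ψ) := by
  refine continuous_subtype_val.add (continuous_finsetSum _ fun i _ => ?_)
  exact (continuous_cutoff.comp (by fun_prop)).smul (continuous_displacement Ψ i)

lemma IsClose.norm_preInitial_sub_le {δ : ℝ} {Ψ : Act F2 S2} (h : IsClose δ Ψ) (x : S2) :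
    ‖preInitial Ψ x - x‖ ≤ 40 * δ := by
  rw [preInitial, add_sub_cancel_left]
  refine (norm_sum_le_of_le (f := fun i => cutoff (inner ℝ (axis i : E3) (x : E3)) •
    displacement Ψ i x) _ (n := fun _ => 20 * δ) fun i _ => ?_).trans_eq ?_
  · rw [norm_smul, Real.norm_of_nonneg (cutoff_nonneg _)]
    exact (mul_le_of_le_one_left (norm_nonneg _) (cutoff_le_one _)).trans
      (h.norm_displacement_le i x)
  · simp; ring

lemma IsClose.half_le_norm_preInitial {Ψ : Act F2 S2} (h : IsClose (1 / 80) Ψ) (x : S2) :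
    1 / 2 ≤ ‖preInitial Ψ x‖ := by
  have h1 := h.norm_preInitial_sub_le x
  have h2 := norm_sub_norm_le (x : E3) (preInitial Ψ x)
  rw [norm_sub_rev, S2.norm_eq] at h2
  linarith

open Classical in
/-- The normalization of `preInitial Ψ`, a map of the sphere. Where `preInitial Ψ` vanishes, which
does not happen if `Ψ` is close to the model action, the value is irrelevant. -/
noncomputable def initialMap (Ψ : Act F2 S2) (x : S2) : S2 :=
  if h : preInitial Ψ x = 0 then x
  else ⟨‖preInitial Ψ x‖⁻¹ • preInitial Ψ x, by simpa using norm_smul_inv_norm (𝕜 := ℝ) h⟩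

lemma IsClose.initialMap_coe {Ψ : Act F2 S2} (h : IsClose (1 / 80) Ψ) (x : S2) :
    (initialMap Ψ x : E3) = ‖preInitial Ψ x‖⁻¹ • preInitial Ψ x := by
  have h1 : preInitial Ψ x ≠ 0 := by
    rw [← norm_pos_iff]; linarith [h.half_le_norm_preInitial x]
  rw [initialMap, dif_neg h1]

lemma initialMap_eq_of_preInitial_eq {Ψ : Act F2 S2} {x y : S2} (h : preInitial Ψ x = y) :
    initialMap Ψ x = y := by
  have h1 : preInitial Ψ x ≠ 0 := by
    rw [← norm_pos_iff, h, S2.norm_eq]; exact one_pos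
  rw [initialMap, dif_neg h1]
  apply Subtype.ext
  show ‖preInitial Ψ x‖⁻¹ • preInitial Ψ x = y
  rw [h, S2.norm_eq, inv_one, one_smul]

lemma IsClose.continuous_initialMap {Ψ : Act F2 S2} (h : IsClose (1 / 80) Ψ) :
    Continuous (initialMap Ψ) := by
  rw [continuous_induced_rng]
  have : (Subtype.val ∘ initialMap Ψ) = fun x => ‖preInitial Ψ x‖⁻¹ • preInitial Ψ x :=
    funext h.initialMap_coe
  rw [this]
  exact ((continuous_preInitial Ψ).norm.inv₀ fun x =>
    (by linarith [h.half_le_norm_preInitial x] : (0 : ℝ) < ‖preInitial Ψ x‖).ne').smul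
    (continuous_preInitial Ψ)

lemma IsClose.dist_initialMap_le {δ : ℝ} {Ψ : Act F2 S2} (h : IsClose δ Ψ) (hδ : δ ≤ 1 / 80)
    (x : S2) : dist (initialMap Ψ x) x ≤ 80 * δ := by
  have h80 := h.mono hδ
  have h1 := h.norm_preInitial_sub_le x
  have h2 := h80.half_le_norm_preInitial x
  have h3 : ‖(initialMap Ψ x : E3) - preInitial Ψ x‖ ≤ ‖preInitial Ψ x - x‖ := by
    have e : (initialMap Ψ x : E3) - preInitial Ψ x =
        (‖preInitial Ψ x‖⁻¹ - 1) • preInitial Ψ x := by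
      rw [h80.initialMap_coe, sub_smul, one_smul]
    rw [e, norm_smul, Real.norm_eq_abs, ← abs_norm (preInitial Ψ x), ← abs_mul, abs_norm, sub_mul,
      inv_mul_cancel₀ (by linarith : (0 : ℝ) < ‖preInitial Ψ x‖).ne', one_mul, ← S2.norm_eq x,
      norm_sub_rev (preInitial Ψ x)]
    exact abs_norm_sub_norm_le _ _
  rw [Subtype.dist_eq, dist_eq_norm]
  have h4 := norm_sub_le_norm_sub_add_norm_sub (initialMap Ψ x : E3) (preInitial Ψ x) x
  linarith

lemma inner_axis_of_le {i j : Fin 2} (hij : i ≠ j) {x : S2}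
    (hx : 3 / 4 ≤ |inner ℝ (axis i : E3) (x : E3)|) :
    -(18 / 25) ≤ inner ℝ (axis j : E3) (x : E3) := by
  have h1 := inner_pole_sq_add_le (s := (i, true)) (s' := (j, true)) hij x
  change inner ℝ (axis i : E3) (x : E3) ^ 2 + inner ℝ (axis j : E3) (x : E3) ^ 2 ≤ 1 at h1
  rw [← sq_abs (inner ℝ (axis i : E3) (x : E3))] at h1
  exact (abs_le.1 (abs_le_of_sq_le_sq (by nlinarith) (by norm_num))).1

lemma cutoff_smul_eq_zero_of_ne {Ψ : Act F2 S2} {i j : Fin 2} (hij : j ≠ i) {x : S2}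
    (hx : 3 / 4 ≤ |inner ℝ (axis i : E3) (x : E3)|) :
    cutoff (inner ℝ (axis j : E3) (x : E3)) • displacement Ψ j x = 0 := by
  rw [cutoff_eq_zero (inner_axis_of_le hij.symm hx), zero_smul]

lemma initialMap_eq_self {Ψ : Act F2 S2} {i : Fin 2} {x : S2}
    (hx : 3 / 4 ≤ inner ℝ (axis i : E3) (x : E3)) : initialMap Ψ x = x := by
  apply initialMap_eq_of_preInitial_eq
  rw [preInitial, Finset.sum_eq_zero, add_zero]
  intro j _
  by_cases hij : j = i
  · rw [hij, cutoff_eq_zero (by linarith), zero_smul]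
  · exact cutoff_smul_eq_zero_of_ne hij (hx.trans (le_abs_self _))

lemma initialMap_eq_boost {Ψ : Act F2 S2} {i : Fin 2} {x : S2}
    (hx : inner ℝ (axis i : E3) (x : E3) ≤ -(3 / 4)) :
    initialMap Ψ x = boost (-axis i) (Ψ (FreeGroup.of i) x) := by
  apply initialMap_eq_of_preInitial_eq
  rw [preInitial, Finset.sum_eq_single i, cutoff_eq_one hx, one_smul, displacement,
    add_sub_cancel]
  · exact fun j _ hij => cutoff_smul_eq_zero_of_ne hij (by rw [le_abs]; right; linarith)
  · exact fun h => absurd (Finset.mem_univ i) h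

/-- Where one of the two region functions is nonnegative they agree: there `initialMap Ψ` is the
identity or `Φ⁻¹ ∘ Ψ` for a generator, according to the sign of the letter. -/
lemma IsClose.regionFun_initialMap {Ψ : Act F2 S2} (h : IsClose (1 / 4000) Ψ) (s : Letter)
    (x : S2) : regionFun boostAct s (initialMap Ψ x) = regionFun Ψ s x ∨
      (regionFun boostAct s (initialMap Ψ x) < 0 ∧ regionFun Ψ s x < 0) := by
  by_cases hx : 3 / 4 ≤ inner ℝ (pole s : E3) (x : E3)
  · left
    rcases s with ⟨i, _ | _⟩
    · change 3 / 4 ≤ inner ℝ ((-axis i : S2) : E3) (x : E3) at hx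
      rw [S2.inner_neg_left] at hx
      show 24 / 25 - inner ℝ (axis i : E3) (boostAct (FreeGroup.of i) (initialMap Ψ x) : E3) =
        24 / 25 - inner ℝ (axis i : E3) (Ψ (FreeGroup.of i) x : E3)
      rw [initialMap_eq_boost (i := i) (by linarith), boostAct_of, boost_boost_neg]
    · rw [initialMap_eq_self (i := i) hx]; rfl
  · right
    rw [not_le] at hx
    refine ⟨regionFun_boostAct_neg ?_, (h.mono (by norm_num)).regionFun_neg hx⟩
    have h1 := h.dist_initialMap_le (by norm_num) x
    have h2 := (abs_le.1 (abs_inner_sub_inner_le (pole s) (initialMap Ψ x) x)).2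
    linarith

/-- The semiconjugacy equation on the boundaries of the regions. -/
lemma IsClose.initialMap_act {Ψ : Act F2 S2} (h : IsClose (1 / 4000) Ψ) {s : Letter} {x : S2}
    (hx : regionFun Ψ s.inv x = 0) :
    initialMap Ψ (Ψ s.elt x) = boostAct s.elt (initialMap Ψ x) := by
  have hpole := (h.mono (by norm_num)).le_inner_pole hx.ge
  rcases s with ⟨i, _ | _⟩
  · change inner ℝ (axis i : E3) (x : E3) - 24 / 25 = 0 at hx
    have hinv : Ψ (FreeGroup.of i) (Ψ (FreeGroup.of i)⁻¹ x) = x := act_act_inv Ψ (i, true) x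
    have h2 : regionFun Ψ (i, false) (Ψ (FreeGroup.of i)⁻¹ x) = 0 := by
      show 24 / 25 - inner ℝ (axis i : E3) (Ψ (FreeGroup.of i) (Ψ (FreeGroup.of i)⁻¹ x) : E3) = 0
      rw [hinv]; linarith
    have h3 : 3 / 4 ≤ inner ℝ ((-axis i : S2) : E3) (Ψ (FreeGroup.of i)⁻¹ x : E3) :=
      (h.mono (by norm_num)).le_inner_pole h2.ge
    rw [S2.inner_neg_left] at h3
    rw [boostAct_elt, initialMap_eq_self (i := i) (x := x) (by linarith)]
    show initialMap Ψ (Ψ (FreeGroup.of i)⁻¹ x) = boost (-axis i) x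
    rw [initialMap_eq_boost (i := i) (by linarith), hinv]
  · change 24 / 25 - inner ℝ (axis i : E3) (Ψ (FreeGroup.of i) x : E3) = 0 at hx
    change 3 / 4 ≤ inner ℝ ((-axis i : S2) : E3) (x : E3) at hpole
    rw [S2.inner_neg_left] at hpole
    rw [boostAct_elt, initialMap_eq_boost (i := i) (x := x) (by linarith)]
    show initialMap Ψ (Ψ (FreeGroup.of i) x) = boost (axis i) _
    rw [boost_boost_neg, initialMap_eq_self (i := i) (by linarith)]

lemma IsClose.semiconjData {δ : ℝ} {Ψ : Act F2 S2} (h : IsClose δ Ψ) (hδ0 : 0 ≤ δ)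
    (hδ : δ ≤ 1 / 4000) : SemiconjData boostAct Ψ (regionFun boostAct) (regionFun Ψ)
      (initialMap Ψ) (1 / 2) (2000 * δ) where
  left := pingPong_boostAct
  right := (h.mono (by linarith)).pingPong
  cont := (h.mono (by linarith)).continuous_initialMap
  sign := (h.mono hδ).regionFun_initialMap
  compat _ _ hx := (h.mono hδ).initialMap_act hx
  rho_nonneg := by norm_num
  rho_lt_one := by norm_num
  contracts := contracts_boostAct
  close x := (h.dist_initialMap_le (by linarith) x).trans (by linarith)
  close_base s x := by
    have h1 := dist_boostAct_le_twenty s (initialMap Ψ x) x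
    have h2 := h.dist_initialMap_le (by linarith) x
    have h3 := h s x
    have h4 := dist_triangle (boostAct s.elt (initialMap Ψ x)) (boostAct s.elt x) (Ψ s.elt x)
    rw [dist_comm] at h3
    linarith
  close_step s s' x y hne hx hy hxy := by
    have h1 := dist_boostAct_le hne (inner_pole_ge_of_nonneg hy)
      ((h.mono (by linarith)).le_inner_pole hx)
    have h3 := h s x
    have h4 := dist_triangle (boostAct s.elt y) (boostAct s.elt x) (Ψ s.elt x)
    rw [dist_comm] at h3
    linarith

/-- The semiconjugacy from an action `Ψ` that is `C⁰`-close to the ping-pong action. -/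
theorem IsClose.exists_semiconj {δ : ℝ} {Ψ : Act F2 S2} (h : IsClose δ Ψ) (hδ0 : 0 ≤ δ)
    (hδ : δ ≤ 1 / 5000) : ∃ f : S2 → S2, IsSemiconj f Ψ boostAct ∧
      (∀ x, dist (f x) x ≤ 2000 * δ) ∧
      (∀ x, (∀ s, regionFun Ψ s x ≤ 0) →
        f x = initialMap Ψ x ∧ ∀ s, regionFun boostAct s (f x) ≤ 0) ∧
      ∀ s x, 0 < regionFun Ψ s x → 0 < regionFun boostAct s (f x) := by
  obtain ⟨f, hf, hsemi, hclose, hoff, hpos⟩ := (h.semiconjData hδ0 (by linarith)).exists_semiconj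
  refine ⟨f, ⟨hf, surjective_of_dist_lt hf fun x => (hclose x).trans_lt ?_, hsemi⟩, hclose, hoff,
    hpos⟩
  linarith

/-- `C⁰`-stability, by semiconjugacies that carry limit set to limit set. -/
theorem isC0Stable_and_limitSet (ε : ℝ) (hε : 0 < ε) : ∃ δ : ℝ, 0 < δ ∧ ∀ Ψ : Act F2 S2,
    actDist0 symGen Ψ boostAct < ENNReal.ofReal δ →
      ∃ h : S2 → S2, IsSemiconj h Ψ boostAct ∧ dC0 h id < ENNReal.ofReal ε ∧
        h '' limitSet Ψ boostCap = limitSet boostAct boostCap ∧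
        ∀ x ∈ limitSet Ψ boostCap, ∀ y ∈ connectedComponentIn (limitSet Ψ boostCap) x,
          h y = h x := by
  refine ⟨min (1 / 5000) (ε / 4000), lt_min (by norm_num) (by positivity), fun Ψ hΨ => ?_⟩
  have hmin0 : 0 ≤ min (1 / 5000) (ε / 4000) := le_min (by norm_num) (by positivity)
  obtain ⟨h, hsemi, hclose, hoff, hpos⟩ :=
    (isClose_of_actDist0_lt hmin0 hΨ).exists_semiconj hmin0 (min_le_left _ _)
  have hiff := mem_pingPongSet_iff_of_semiconj hsemi.2.2 (fun x hx => (hoff x hx).2) hpos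
  refine ⟨h, hsemi, ?_, ?_, fun x hx y hy => ?_⟩
  · have hle : dC0 h id ≤ ENNReal.ofReal (ε / 2) := iSup_le fun x => by
      rw [edist_dist]
      refine ENNReal.ofReal_le_ofReal ((hclose x).trans ?_)
      linarith [min_le_right (1 / 5000) (ε / 4000)]
    exact hle.trans_lt ((ENNReal.ofReal_lt_ofReal_iff hε).2 (by linarith))
  · rw [limitSet_eq, limitSet_eq]
    have : pingPongSet Ψ (regionFun Ψ) = h ⁻¹' pingPongSet boostAct (regionFun boostAct) :=
      Set.ext fun x => (hiff x).symm
    rw [this, image_preimage_eq _ hsemi.2.1]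
  · rw [limitSet_eq] at hx hy
    refine isCantorSet_boostAct.2.2.1 (h '' connectedComponentIn (pingPongSet Ψ (regionFun Ψ)) x)
      ?_ (isPreconnected_connectedComponentIn.image _ hsemi.1.continuousOn)
      (mem_image_of_mem _ hy) (mem_image_of_mem _ (mem_connectedComponentIn hx))
    rintro _ ⟨z, hz, rfl⟩
    exact (hiff z).2 (connectedComponentIn_subset _ _ hz)

/-! ### The difference of two `C¹`-close maps of the sphere is Lipschitz -/

/-- The derivative of `f` along a curve `γ`, in terms of `sphereDeriv`. -/
lemma hasDerivAt_comp_sphere {f : S2 → S2} (hf : ContMDiff (𝓡 2) (𝓡 2) 1 f) {γ : ℝ → S2}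
    (hγ : ContMDiff 𝓘(ℝ, ℝ) (𝓡 2) 1 γ) (t : ℝ) :
    HasDerivAt (fun s => (f (γ s) : E3))
      (sphereDeriv f (γ t) (mfderiv 𝓘(ℝ, ℝ) (𝓡 2) γ t (1 : ℝ))) t := by
  have h1 : MDifferentiableAt (𝓡 2) 𝓘(ℝ, E3) (fun y => (f y : E3)) (γ t) :=
    ((S2.contMDiff_coe.comp hf).mdifferentiable one_ne_zero) (γ t)
  have h2 : MDifferentiableAt 𝓘(ℝ, ℝ) (𝓡 2) γ t := (hγ.mdifferentiable one_ne_zero) t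
  have h3 : HasFDerivAt (𝕜 := ℝ) (E := ℝ) (F := E3) (fun s => (f (γ s) : E3)) _ t :=
    (h1.hasMFDerivAt.comp t h2.hasMFDerivAt).hasFDerivAt
  exact h3.hasDerivAt

lemma contMDiff_greatCircle {x u : E3} (hx : ‖x‖ = 1) (hu : ‖u‖ = 1) (hxu : inner ℝ x u = 0) :
    ContMDiff 𝓘(ℝ, ℝ) (𝓡 2) 1
      fun t => (⟨Real.cos t • x + Real.sin t • u, greatCircle_mem hx hu hxu t⟩ : S2) := by
  have : Fact (Module.finrank ℝ E3 = 2 + 1) := ⟨finrank_euclideanSpace_fin⟩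
  have h : ContDiff ℝ 1 fun t : ℝ => Real.cos t • x + Real.sin t • u :=
    (Real.contDiff_cos.smul contDiff_const).add (Real.contDiff_sin.smul contDiff_const)
  exact h.contMDiff.codRestrict_sphere _

/-- Integration of the difference of the derivatives along the great circle arc from `x` to
`y`. -/
lemma norm_sub_sub_le_of_dC1 {f g : S2 → S2} (hf : ContMDiff (𝓡 2) (𝓡 2) 1 f)
    (hg : ContMDiff (𝓡 2) (𝓡 2) 1 g) {δ : ℝ} (hδ : 0 ≤ δ) (h : dC1 f g ≤ ENNReal.ofReal δ)
    (x y : S2) : ‖((f x : E3) - g x) - ((f y : E3) - g y)‖ ≤ 2 * δ * dist x y := by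
  obtain ⟨u, θ, hu, hxu, hθ, hy⟩ := exists_polar x y
  let γ : ℝ → S2 := fun t => ⟨_, greatCircle_mem (S2.norm_eq x) hu hxu t⟩
  have hγ : ContMDiff 𝓘(ℝ, ℝ) (𝓡 2) 1 γ := contMDiff_greatCircle (S2.norm_eq x) hu hxu
  have hγ0 : γ 0 = x := Subtype.ext (by simp [γ])
  have hγθ : γ θ = y := Subtype.ext hy.symm
  have hspeed : ∀ t, ‖sphereDeriv id (γ t) (mfderiv 𝓘(ℝ, ℝ) (𝓡 2) γ t (1 : ℝ))‖ = 1 := by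
    intro t
    have h1 := hasDerivAt_comp_sphere contMDiff_id hγ t
    have h2 : HasDerivAt (fun s => (id (γ s) : E3))
        (Real.cos (t + Real.pi / 2) • (x : E3) + Real.sin (t + Real.pi / 2) • u) t := by
      rw [Real.cos_add_pi_div_two, Real.sin_add_pi_div_two]
      exact ((Real.hasDerivAt_cos t).smul_const (x : E3)).add
        ((Real.hasDerivAt_sin t).smul_const u)
    rw [h1.unique h2]
    exact mem_sphere_zero_iff_norm.1 (greatCircle_mem (S2.norm_eq x) hu hxu _)
  have hderiv : ∀ t, HasDerivAt (fun s => (f (γ s) : E3) - g (γ s)) _ t := fun t =>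
    (hasDerivAt_comp_sphere hf hγ t).sub (hasDerivAt_comp_sphere hg hγ t)
  have hbound : ∀ t, ‖sphereDeriv f (γ t) (mfderiv 𝓘(ℝ, ℝ) (𝓡 2) γ t (1 : ℝ)) -
      sphereDeriv g (γ t) (mfderiv 𝓘(ℝ, ℝ) (𝓡 2) γ t (1 : ℝ))‖ ≤ δ := by
    intro t
    rw [← dist_eq_norm, ← ENNReal.ofReal_le_ofReal_iff hδ, ← edist_dist]
    refine le_trans ?_ ((le_max_right _ _).trans h)
    exact le_iSup_of_le (γ t) (le_iSup₂_of_le (mfderiv 𝓘(ℝ, ℝ) (𝓡 2) γ t (1 : ℝ))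
      (hspeed t).le le_rfl)
  have hmv := (convex_Icc 0 θ).norm_image_sub_le_of_norm_hasDerivWithin_le
    (fun t _ => (hderiv t).hasDerivWithinAt) (fun t _ => hbound t)
    (right_mem_Icc.2 hθ.1) (left_mem_Icc.2 hθ.1)
  simp only [hγ0, hγθ] at hmv
  rw [zero_sub, norm_neg, Real.norm_of_nonneg hθ.1] at hmv
  refine hmv.trans ?_
  -- An arc of length at most `π` is at most twice as long as its chord.
  have hchord : θ ≤ 2 * dist x y := by
    have h1 := Real.cos_le_one_sub_mul_cos_sq (abs_le.2 ⟨by linarith [hθ.1, Real.pi_pos], hθ.2⟩)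
    have h2 : inner ℝ (x : E3) (y : E3) = Real.cos θ := by
      rw [hy, inner_add_right, inner_smul_right, inner_smul_right, S2.inner_self, hxu]; ring
    have h3 := S2.dist_sq x y
    rw [h2] at h3
    have hπ : Real.pi ^ 2 ≤ 16 := by nlinarith [Real.pi_le_four, Real.pi_pos]
    have h4 : 1 / 8 * θ ^ 2 ≤ 2 / Real.pi ^ 2 * θ ^ 2 := by
      refine mul_le_mul_of_nonneg_right ?_ (sq_nonneg θ)
      rw [div_le_div_iff₀ (by norm_num) (by positivity)]
      linarith
    refine le_of_sq_le_sq ?_ (by positivity)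
    nlinarith
  nlinarith

/-! ### Injectivity of the semiconjugacy for `C¹`-close actions -/

/-- `f` is bounded by `ε`, and Lipschitz with the constant `ε`. -/
structure IsSmallLip {F : Type*} [NormedAddCommGroup F] (ε : ℝ) (f : S2 → F) : Prop where
  norm_le : ∀ x, ‖f x‖ ≤ ε
  norm_sub_le : ∀ x y, ‖f x - f y‖ ≤ ε * dist x y

namespace IsSmallLip

variable {F : Type*} [NormedAddCommGroup F] {ε η : ℝ} {f g : S2 → F}

lemma add (hf : IsSmallLip ε f) (hg : IsSmallLip η g) : IsSmallLip (ε + η) fun x => f x + g x where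
  norm_le x := norm_add_le_of_le (hf.norm_le x) (hg.norm_le x)
  norm_sub_le x y := by
    rw [add_sub_add_comm, add_mul]
    exact norm_add_le_of_le (hf.norm_sub_le x y) (hg.norm_sub_le x y)

lemma mono (hf : IsSmallLip ε f) (h : ε ≤ η) : IsSmallLip η f where
  norm_le x := (hf.norm_le x).trans h
  norm_sub_le x y := (hf.norm_sub_le x y).trans (mul_le_mul_of_nonneg_right h dist_nonneg)

variable [NormedSpace ℝ F]

lemma smul {c : S2 → ℝ} (hc : IsSmallLip η c) (hf : IsSmallLip ε f) :
    IsSmallLip (2 * η * ε) fun x => c x • f x where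
  norm_le x := by
    have h0 := (norm_nonneg _).trans (hc.norm_le x)
    have h1 := (norm_nonneg _).trans (hf.norm_le x)
    rw [norm_smul]
    have := mul_le_mul (hc.norm_le x) (hf.norm_le x) (norm_nonneg _) h0
    nlinarith [mul_nonneg h0 h1]
  norm_sub_le x y := by
    have h0 := (norm_nonneg _).trans (hc.norm_le x)
    have e : c x • f x - c y • f y = c x • (f x - f y) + (c x - c y) • f y := by module
    rw [e]
    refine (norm_add_le _ _).trans ?_
    rw [norm_smul, norm_smul]
    have h1 := mul_le_mul (hc.norm_le x) (hf.norm_sub_le x y) (norm_nonneg _) h0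
    have h2 := mul_le_mul (hc.norm_sub_le x y) (hf.norm_le y) (norm_nonneg _)
      (mul_nonneg h0 dist_nonneg)
    linarith

lemma const_smul (c : ℝ) (hf : IsSmallLip ε f) : IsSmallLip (|c| * ε) fun x => c • f x where
  norm_le x := by
    rw [norm_smul, Real.norm_eq_abs]; exact mul_le_mul_of_nonneg_left (hf.norm_le x) (abs_nonneg c)
  norm_sub_le x y := by
    rw [← smul_sub, norm_smul, Real.norm_eq_abs, mul_assoc]
    exact mul_le_mul_of_nonneg_left (hf.norm_sub_le x y) (abs_nonneg c)

lemma inner_left (p : S2) {f : S2 → E3} (hf : IsSmallLip ε f) :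
    IsSmallLip ε fun x => inner ℝ (p : E3) (f x) where
  norm_le x := by
    refine (norm_inner_le_norm _ _).trans ?_
    rw [S2.norm_eq, one_mul]; exact hf.norm_le x
  norm_sub_le x y := by
    rw [← inner_sub_right]
    refine (norm_inner_le_norm _ _).trans ?_
    rw [S2.norm_eq, one_mul]; exact hf.norm_sub_le x y

end IsSmallLip

lemma isSmallLip_coe : IsSmallLip 1 (Subtype.val : S2 → E3) where
  norm_le x := (S2.norm_eq x).le
  norm_sub_le x y := by rw [one_mul, Subtype.dist_eq, dist_eq_norm]

lemma isSmallLip_const (v : E3) : IsSmallLip ‖v‖ fun _ : S2 => v where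
  norm_le _ := le_rfl
  norm_sub_le x y := by
    rw [sub_self, norm_zero]; exact mul_nonneg (norm_nonneg _) dist_nonneg

lemma isSmallLip_cutoff (i : Fin 2) :
    IsSmallLip 40 fun x : S2 => cutoff (inner ℝ (axis i : E3) (x : E3)) where
  norm_le x := by
    rw [Real.norm_of_nonneg (cutoff_nonneg _)]
    exact (cutoff_le_one _).trans (by norm_num)
  norm_sub_le x y := by
    refine (abs_cutoff_sub_le _ _).trans ?_
    have := abs_inner_sub_inner_le (axis i) x y
    nlinarith [dist_nonneg (x := x) (y := y)]

/-- The difference of two values of a boost is controlled by the difference of the arguments,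
with coefficients that are again Lipschitz. -/
lemma boostVec_sub_boostVec (q u v : S2) : boostVec q u - boostVec q v =
    (boostDen q u)⁻¹ • ((40 : ℝ) • ((u : E3) - v) +
      ((361 : ℝ) • (inner ℝ (q : E3) ((u : E3) - v) • (q : E3)) +
        (-399 : ℝ) • (inner ℝ (q : E3) ((u : E3) - v) • boostVec q v))) := by
  have hu := (boostDen_pos q u).ne'
  have hv := (boostDen_pos q v).ne'
  rw [inner_sub_right]
  unfold boostVec
  match_scalars
  · field_simp
  · field_simp
    simp only [boostDen]; ring
  · field_simp
    simp only [boostDen]; ring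

/-- If `ψ` is close to the boost with pole `p` up to a small Lipschitz error, then
`boost (-p) ∘ ψ` is the identity up to a small Lipschitz error. -/
lemma isSmallLip_boost_neg_sub {p : S2} {ψ : S2 → S2} {δ : ℝ} (hδ0 : 0 ≤ δ) (hδ : δ ≤ 1)
    (h : IsSmallLip δ fun x => (ψ x : E3) - boost p x) :
    IsSmallLip (10000000 * δ) fun x => (boost (-p) (ψ x) : E3) - x := by
  have hin := h.inner_left (-p)
  have hnum := (h.const_smul 40).add (((hin.smul (isSmallLip_const ((-p : S2) : E3))).const_smul
    361).add ((hin.smul isSmallLip_coe).const_smul (-399)))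
  have hψ : ∀ x y, dist (ψ x) (ψ y) ≤ 21 * dist x y := fun x y => by
    have h1 := h.norm_sub_le x y
    have h2 := dist_boost_le_twenty p x y
    rw [Subtype.dist_eq, dist_eq_norm] at h2 ⊢
    have e : (ψ x : E3) - ψ y = ((ψ x : E3) - boost p x - ((ψ y : E3) - boost p y)) +
        ((boost p x : E3) - boost p y) := by abel
    have h3 := norm_add_le ((ψ x : E3) - boost p x - ((ψ y : E3) - boost p y))
      ((boost p x : E3) - boost p y)
    rw [← e] at h3
    have h4 := mul_le_mul_of_nonneg_right hδ (dist_nonneg (x := x) (y := y))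
    linarith
  have hden : IsSmallLip 2100 fun x => (boostDen (-p : S2) (ψ x))⁻¹ := by
    refine ⟨fun x => ?_, fun x y => ?_⟩
    · have h1 := boostDen_ge (-p) (ψ x)
      rw [Real.norm_of_nonneg (inv_nonneg.2 (by linarith))]
      exact (inv_anti₀ two_pos h1).trans (by norm_num)
    · have h1 := boostDen_ge (-p) (ψ x)
      have h2 := boostDen_ge (-p) (ψ y)
      have h3 := abs_inner_sub_inner_le (-p) (ψ y) (ψ x)
      rw [dist_comm] at h3
      have h4 : boostDen (-p : S2) (ψ y) - boostDen (-p : S2) (ψ x) =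
          399 * (inner ℝ ((-p : S2) : E3) (ψ y : E3) - inner ℝ ((-p : S2) : E3) (ψ x : E3)) := by
        simp only [boostDen]; ring
      rw [inv_sub_inv (by linarith) (by linarith), norm_div, Real.norm_eq_abs, Real.norm_eq_abs,
        h4, abs_mul, abs_of_pos (mul_pos (boostDen_pos _ _) (boostDen_pos _ _)),
        div_le_iff₀ (mul_pos (boostDen_pos _ _) (boostDen_pos _ _))]
      rw [abs_of_pos (by norm_num : (0 : ℝ) < 399)]
      have h5 := hψ x y
      have h6 : 4 ≤ boostDen (-p : S2) (ψ x) * boostDen (-p : S2) (ψ y) := by nlinarith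
      have h7 := mul_le_mul_of_nonneg_left h6 (by positivity : 0 ≤ 2100 * dist x y)
      linarith [dist_nonneg (x := x) (y := y)]
  have hall := hden.smul hnum
  have hform := fun x => boostVec_sub_boostVec (-p) (ψ x) (boost p x)
  simp only [← boost_coe, boost_neg_boost] at hform
  rw [funext hform]
  refine hall.mono ?_
  rw [S2.norm_eq, abs_of_pos (by norm_num : (0 : ℝ) < 40),
    abs_of_pos (by norm_num : (0 : ℝ) < 361), abs_of_neg (by norm_num : (-399 : ℝ) < 0)]
  linarith

/-- The normalization of a small Lipschitz perturbation of the identity is injective. -/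
lemma eq_of_normalize_eq {e : S2 → E3} (he : IsSmallLip (1 / 10) e) {x y : S2}
    (h : ‖(x : E3) + e x‖⁻¹ • ((x : E3) + e x) = ‖(y : E3) + e y‖⁻¹ • ((y : E3) + e y)) :
    x = y := by
  set v : S2 → E3 := fun z => (z : E3) + e z with hv
  change ‖v x‖⁻¹ • v x = ‖v y‖⁻¹ • v y at h
  have hn : ∀ z, 9 / 10 ≤ ‖v z‖ := fun z => by
    have h1 := norm_sub_norm_le (z : E3) (-e z)
    rw [sub_neg_eq_add, norm_neg, S2.norm_eq] at h1
    linarith [he.norm_le z]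
  have hsq : ∀ z, ‖v z‖ ^ 2 = 1 + 2 * inner ℝ (z : E3) (e z) + ‖e z‖ ^ 2 := fun z => by
    rw [norm_add_sq_real, S2.norm_eq, one_pow]
  have hd := dist_nonneg (x := x) (y := y)
  have hee := he.norm_sub_le x y
  -- The difference of the lengths of `v x` and `v y`.
  have h1 : |inner ℝ (x : E3) (e x) - inner ℝ (y : E3) (e y)| ≤ 1 / 5 * dist x y := by
    have e1 : inner ℝ (x : E3) (e x) - inner ℝ (y : E3) (e y) =
        inner ℝ (x : E3) (e x - e y) + inner ℝ ((x : E3) - y) (e y) := by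
      rw [inner_sub_left, inner_sub_right]; ring
    rw [e1]
    have h2 := norm_inner_le_norm (𝕜 := ℝ) (x : E3) (e x - e y)
    have h3 := norm_inner_le_norm (𝕜 := ℝ) ((x : E3) - y) (e y)
    rw [S2.norm_eq, one_mul] at h2
    rw [← dist_eq_norm, ← Subtype.dist_eq] at h3
    have h4 := mul_le_mul_of_nonneg_left (he.norm_le y) hd
    refine (abs_add_le _ _).trans ?_
    rw [Real.norm_eq_abs] at h2 h3
    linarith
  have h2 : |‖e x‖ ^ 2 - ‖e y‖ ^ 2| ≤ 1 / 50 * dist x y := by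
    rw [sq_sub_sq, abs_mul, abs_of_nonneg (add_nonneg (norm_nonneg _) (norm_nonneg _))]
    have h3 := (abs_norm_sub_norm_le (e x) (e y)).trans hee
    have h4 : ‖e x‖ + ‖e y‖ ≤ 1 / 5 := by linarith [he.norm_le x, he.norm_le y]
    have := mul_le_mul h4 h3 (abs_nonneg _) (by norm_num)
    linarith
  have h3 : |‖v x‖ - ‖v y‖| ≤ 21 / 50 * dist x y := by
    have h4 : |‖v x‖ ^ 2 - ‖v y‖ ^ 2| ≤ 21 / 50 * dist x y := by
      rw [hsq, hsq, abs_le]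
      have h5 := abs_le.1 h1
      have h6 := abs_le.1 h2
      constructor <;> linarith [h5.1, h5.2, h6.1, h6.2]
    rw [sq_sub_sq, abs_mul, abs_of_nonneg (add_nonneg (norm_nonneg _) (norm_nonneg _))] at h4
    refine le_trans ?_ h4
    exact le_mul_of_one_le_left (abs_nonneg _) (by linarith [hn x, hn y])
  -- `v x` and `v y` lie on one ray, so that this is also the length of their difference.
  have h4 : ‖v x - v y‖ = |‖v x‖ - ‖v y‖| := by
    have hx : ‖v x‖ ≠ 0 := by linarith [hn x]
    have hy : ‖v y‖ ≠ 0 := by linarith [hn y]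
    have e1 : v x = (‖v x‖ * ‖v y‖⁻¹) • v y := by
      rw [mul_smul, ← h, smul_smul, mul_inv_cancel₀ hx, one_smul]
    have e2 : v x - v y = ((‖v x‖ - ‖v y‖) * ‖v y‖⁻¹) • v y := by
      rw [sub_mul, mul_inv_cancel₀ hy, sub_smul, one_smul, ← e1]
    rw [e2, norm_smul, norm_mul, norm_inv, norm_norm, mul_assoc, inv_mul_cancel₀ hy, mul_one,
      Real.norm_eq_abs]
  have h5 : dist x y ≤ ‖v x - v y‖ + 1 / 10 * dist x y := by
    have e1 : (x : E3) - y = (v x - v y) - (e x - e y) := by simp only [hv]; abel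
    rw [Subtype.dist_eq, dist_eq_norm] at hee ⊢
    have := norm_sub_le (v x - v y) (e x - e y)
    rw [← e1] at this
    linarith
  exact dist_le_zero.1 (by linarith)

/-- Under `Ψ`, every letter differs from the corresponding boost by a map with values and
Lipschitz constant at most `δ`. -/
def IsLipClose (δ : ℝ) (Ψ : Act F2 S2) : Prop :=
  ∀ s : Letter, IsSmallLip δ fun x => (Ψ s.elt x : E3) - boostAct s.elt x

lemma isLipClose_of_actDist1_lt {δ : ℝ} (hδ : 0 ≤ δ) {Ψ : Act F2 S2} (hΨ : IsC1Act symGen Ψ)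
    (h : actDist1 symGen Ψ boostAct < ENNReal.ofReal δ) : IsLipClose (2 * δ) Ψ := by
  intro s
  have hs : s.elt ∈ symGen := mem_range_self s
  have h1 : dC1 (Ψ s.elt) (boostAct s.elt) ≤ ENNReal.ofReal δ :=
    (le_iSup₂ (f := fun s (_ : s ∈ symGen) => dC1 (Ψ s) (boostAct s)) s.elt hs).trans h.le
  refine ⟨fun x => ?_, fun x y => norm_sub_sub_le_of_dC1 (hΨ _ hs)
    (isPingPong_boostAct.diffeo _ hs) hδ h1 x y⟩
  have h2 : edist (Ψ s.elt x) (boostAct s.elt x) ≤ ENNReal.ofReal δ :=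
    (le_iSup (fun x => edist (Ψ s.elt x) (boostAct s.elt x)) x).trans ((le_max_left _ _).trans h1)
  rw [edist_dist, ENNReal.ofReal_le_ofReal_iff hδ, Subtype.dist_eq, dist_eq_norm] at h2
  linarith

namespace IsLipClose

variable {δ : ℝ} {Ψ : Act F2 S2}

lemma isClose (h : IsLipClose δ Ψ) : IsClose δ Ψ := fun s x => by
  rw [Subtype.dist_eq, dist_eq_norm]; exact (h s).norm_le x

lemma contracts (h : IsLipClose δ Ψ) (hδ : δ ≤ 1 / 200) : Contracts Ψ (regionFun Ψ) (3 / 4) := by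
  intro s s' x y hne hx hy
  have hcl := h.isClose.mono hδ
  have h1 := dist_boostAct_le hne (hcl.le_inner_pole hx) (hcl.le_inner_pole hy)
  have h2 := (h s).norm_sub_le x y
  rw [Subtype.dist_eq, dist_eq_norm] at h1
  rw [Subtype.dist_eq (Ψ s.elt x), dist_eq_norm]
  have e : (Ψ s.elt x : E3) - Ψ s.elt y = ((Ψ s.elt x : E3) - boostAct s.elt x -
      ((Ψ s.elt y : E3) - boostAct s.elt y)) + ((boostAct s.elt x : E3) - boostAct s.elt y) := by
    abel
  rw [e]
  have h3 := mul_le_mul_of_nonneg_right hδ (dist_nonneg (x := x) (y := y))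
  refine (norm_add_le _ _).trans ?_
  linarith [dist_nonneg (x := x) (y := y)]

lemma initialMap_injective (h : IsLipClose δ Ψ) (hδ0 : 0 ≤ δ) (hδ : δ ≤ 1 / 20000000000) :
    Function.Injective (initialMap Ψ) := by
  intro x y hxy
  have hdisp : ∀ i, IsSmallLip (10000000 * δ) (displacement Ψ i) := fun i => by
    have h1 := h (i, true)
    rw [boostAct_elt] at h1
    exact isSmallLip_boost_neg_sub hδ0 (by linarith) h1
  have hcut := fun i => (isSmallLip_cutoff i).smul (hdisp i)
  have hsum : IsSmallLip (1 / 10) fun x : S2 =>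
      ∑ i, cutoff (inner ℝ (axis i : E3) (x : E3)) • displacement Ψ i x := by
    simp only [Fin.sum_univ_two]
    exact ((hcut 0).add (hcut 1)).mono (by linarith)
  have hcl := h.isClose.mono (by linarith : δ ≤ 1 / 80)
  have h1 := congrArg (Subtype.val : S2 → E3) hxy
  rw [hcl.initialMap_coe, hcl.initialMap_coe] at h1
  exact eq_of_normalize_eq hsum h1

end IsLipClose

theorem isC1Stable_boostAct : IsC1Stable symGen boostAct := by
  refine ⟨isPingPong_boostAct.diffeo, 1 / 40000000000, by norm_num, fun Ψ hΨ hdist => ?_⟩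
  have hlip := isLipClose_of_actDist1_lt (by norm_num) hΨ hdist
  obtain ⟨h, ⟨hcont, hsurj, hsemi⟩, -, hoff, hpos⟩ :=
    hlip.isClose.exists_semiconj (by norm_num) (by norm_num)
  have hinj : Function.Injective h := by
    refine injective_of_semiconj pingPong_boostAct (hlip.isClose.mono (by norm_num)).pingPong
      (hlip.contracts (by norm_num)) (by norm_num) (by norm_num) hsemi (fun x hx => (hoff x hx).2)
      hpos fun x y hx hy hxy => ?_
    rw [(hoff x hx).1, (hoff y hy).1] at hxy
    exact hlip.initialMap_injective (by norm_num) (by norm_num) hxy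
  exact ⟨Continuous.homeoOfEquivCompactToT2 (f := Equiv.ofBijective h ⟨hinj, hsurj⟩) hcont, hsemi⟩

theorem mainTheorem2 :
    ∃ (Φ : Act F2 S2) (I : Fin 2 → Set S2),
      IsPingPong Φ I ∧
      IsCantorSet (limitSet Φ I) ∧
      IsMinimalSet Φ (limitSet Φ I) ∧
      (∀ M : Set S2, IsMinimalSet Φ M → M = limitSet Φ I) ∧
      ¬ IsExpansive Φ ∧
      IsC0Stable symGen Φ ∧
      IsC1Stable symGen Φ ∧
      (∀ ε : ℝ, 0 < ε → ∃ δ : ℝ, 0 < δ ∧ ∀ Ψ : Act F2 S2,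
        actDist0 symGen Ψ Φ < ENNReal.ofReal δ →
        ∃ h : S2 → S2, IsSemiconj h Ψ Φ ∧ dC0 h id < ENNReal.ofReal ε ∧
          h '' limitSet Ψ I = limitSet Φ I ∧
          ∀ x ∈ limitSet Ψ I, ∀ y ∈ connectedComponentIn (limitSet Ψ I) x, h y = h x) := by
  have hK := isCantorSet_boostAct
  have hc := contracts_boostAct
  have h0 : (0 : ℝ) ≤ 1 / 2 := by norm_num
  have h1 : (1 / 2 : ℝ) < 1 := by norm_num
  refine ⟨boostAct, boostCap, isPingPong_boostAct, ?_, ?_, ?_, not_isExpansive_boostAct,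
    fun ε hε => ?_, isC1Stable_boostAct, isC0Stable_and_limitSet⟩
  · rw [limitSet_eq]; exact hK
  · rw [limitSet_eq]; exact pingPong_boostAct.isMinimalSet hc h0 h1 hK.1
  · intro M hM
    rw [limitSet_eq]; exact pingPong_boostAct.eq_of_isMinimalSet hc h0 h1 hK.1 hM
  · obtain ⟨δ, hδ, h⟩ := isC0Stable_and_limitSet ε hε
    refine ⟨δ, hδ, fun Ψ hΨ => ?_⟩
    obtain ⟨f, hf, hclose, -⟩ := h Ψ hΨ
    exact ⟨f, hf, hclose⟩
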